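/- Let $p$ be a prime, let $\mathbb F=\mathbb F_p$ be the field with $p$ elements (considered fixed), let $1\le d<p$ and $1\le D<p$ be integers, and let $F:\mathbb Z_{\ge 0}\to\mathbb R_{\ge 0}$ be a growth function, i.e. a non-decreasing function. Definitions. For $P:\mathbb F^n\to\mathbb F$ and $h\in\mathbb F^n$ put $D_hP(x)=P(x+h)-P(x)$. $\mathcal P_k(\mathbb F^n)$ is the set of functions $P:\mathbb F^n\to\mathbb F$ with $D_{h_1}\cdots D_{h_{k+1}}P=0$ for all $h_1,\dots,h_{k+1}\in\mathbb F^n$. The rank $\operatorname{rank}_k(P)\in\{0,1,2,\dots\}\cup\{\infty\}$ of a function $P:\mathbb F^n\to\mathbb F$ is the least $r\ge 0$ such that $P=B(Q_1,\dots,Q_r)$ for some $Q_1,\dots,Q_r\in\mathcal P_k(\mathbb F^n)$ and some function $B:\mathbb F^r\to\mathbb F$ ($\infty$ if there is no such $r$). A factor of order $d$ on $\mathbb F^n$ is a collection $\mathcal F=(P_{i,j})_{1\le i\le d,\,1\le j\le M_i}$ with $M_i\ge 0$ and $P_{i,j}\in\mathcal P_i(\mathbb F^n)$; its dimension is $\dim(\mathcal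 F)=M_1+\dots+M_d$, and $\sigma(\mathcal F)$ is the $\sigma$-algebra on $\mathbb F^n$ whose atoms are the nonempty sets $\{x: P_{i,j}(x)=c_{i,j}\text{ for all }i,j\}$. A factor $\mathcal F'$ is an extension of $\mathcal F$ if $\sigma(\mathcal F)\subseteq\sigma(\mathcal F')$. The factor $\mathcal F$ is $F$-regular if $\operatorname{rank}_{i-1}\big(\sum_{j=1}^{M_i}c_jP_{i,j}\big)\ge F(\dim(\mathcal F))$ for all $1\le i\le d$ and all $c_1,\dots,c_{M_i}\in\mathbb F$ that are not all zero. A function has $\mathcal F$-degree at most $D$ if it is a linear combination of (possibly empty) products $\prod_{j=1}^JQ_j$, where each $Q_j$ lies in the linear span of $P_{d_j,1},\dots,P_{d_j,M_{d_j}}$ for some $d_j\in\{1,\dots,d\}$ and $\sum_{j=1}^Jd_j\le D$. Statement (Minimal-degree representation of polynomials). There is a function $C:\mathbb Z_{\ge 0}\to\mathbb Z_{\ge 0}$, depending only on $p$, $d$, $D$ and $F$, such that for every $n\ge 0$, every factor $\mathcal F$ of order $d$ on $\mathbb F^n$ and every $P\in\mathcal P_D(\mathbb F^n)$ that is measurable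 with respect to $\sigma(\mathcal F)$, there exists an $F$-regular extension $\mathcal F'$ of $\mathcal F$ of order $d$ with $\dim(\mathcal F')\le C(\dim(\mathcal F))$ such that $P$ has $\mathcal F'$-degree at most $D$. -/

import Mathlib

open scoped NNReal ENNReal MeasureTheory

/-- `P` is a polynomial of degree at most `d` on `𝔽ⁿ`, `𝔽 = ZMod p`: all `(d+1)`-fold additive
derivatives `D_{h₁} ⋯ D_{h_{d+1}} P` vanish, where `D_h P (x) = P (x + h) - P x`. -/
def IsPolyOfDegreeLE {p n : ℕ} (d : ℕ) (P : (Fin n → ZMod p) → ZMod p) : Prop :=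
  ∀ h : Fin (d + 1) → (Fin n → ZMod p), (List.ofFn h).foldr fwdDiff P = 0

/-- The degree `d` rank of `P`: the least `k` such that `P = B(Q₁, …, Q_k)` for some polynomials
`Q₁, …, Q_k` of degree at most `d` and some function `B : 𝔽ᵏ → 𝔽`; it is `⊤` if there is no
such `k`. -/
noncomputable def degRank {p n : ℕ} (d : ℕ) (P : (Fin n → ZMod p) → ZMod p) : ℕ∞ :=
  ⨅ k ∈ {k : ℕ | ∃ Q : Fin k → (Fin n → ZMod p) → ZMod p,
      (∀ j, IsPolyOfDegreeLE d (Q j)) ∧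
      ∃ B : (Fin k → ZMod p) → ZMod p, ∀ x, P x = B (fun j => Q j x)}, (k : ℕ∞)

/-- A factor of degree (order) `d` on `𝔽ⁿ`. The index `i : Fin d` stands for the degree `i + 1`,
so `poly i j` is the `j`-th polynomial of the degree `i + 1` part. -/
structure PolyFactor (p n d : ℕ) where
  /-- the number of polynomials in the degree `i + 1` part -/
  M : Fin d → ℕ
  /-- the polynomials of the factor -/
  poly : (i : Fin d) → Fin (M i) → (Fin n → ZMod p) → ZMod p
  isPoly : ∀ (i : Fin d) (j : Fin (M i)), IsPolyOfDegreeLE (i.val + 1) (poly i j)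

namespace PolyFactor

variable {p n d : ℕ}

/-- The dimension `M₁ + ⋯ + M_d`. -/
def dim (𝓕 : PolyFactor p n d) : ℕ := ∑ i, 𝓕.M i

/-- The evaluation map into the configuration space `𝔽^{M₁} × ⋯ × 𝔽^{M_d}`. -/
def eval (𝓕 : PolyFactor p n d) (x : Fin n → ZMod p) : (i : Fin d) → Fin (𝓕.M i) → ZMod p :=
  fun i j => 𝓕.poly i j x

/-- The σ-algebra whose atoms are the nonempty level sets of the evaluation map. -/
abbrev sigma (𝓕 : PolyFactor p n d) : MeasurableSpace (Fin n → ZMod p) :=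
  MeasurableSpace.comap 𝓕.eval ⊤

/-- `𝓕'` is an extension of `𝓕`: the σ-algebra of `𝓕'` refines that of `𝓕`. -/
def IsExtension (𝓕' 𝓕 : PolyFactor p n d) : Prop := 𝓕.sigma ≤ 𝓕'.sigma

/-- `F`-regularity: every nontrivial linear combination of the degree `i + 1` part has
degree `i` rank at least `F (dim 𝓕)`. -/
def IsRegular (𝓕 : PolyFactor p n d) (F : ℕ → ℝ≥0) : Prop :=
  ∀ (i : Fin d) (c : Fin (𝓕.M i) → ZMod p), c ≠ 0 →
    (F 𝓕.dim : ℝ≥0∞) ≤ (degRank (i : ℕ) (∑ j, c j • 𝓕.poly i j) : ℝ≥0∞)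

/-- `m` is an `𝓕`-monomial of `𝓕`-degree `e`: a (possibly empty) product of functions `Q j`, each in
the linear span of the degree `δ j + 1` part of `𝓕`, with these degrees adding up to `e`. -/
def IsMonomial (𝓕 : PolyFactor p n d) (e : ℕ) (m : (Fin n → ZMod p) → ZMod p) : Prop :=
  ∃ (J : ℕ) (δ : Fin J → Fin d) (Q : Fin J → (Fin n → ZMod p) → ZMod p),
    (∀ j, Q j ∈ Submodule.span (ZMod p) (Set.range (𝓕.poly (δ j)))) ∧
    m = ∏ j, Q j ∧ e = ∑ j, ((δ j : ℕ) + 1)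

/-- `P` has `𝓕`-degree at most `D`: it is a linear combination of `𝓕`-monomials of `𝓕`-degree
at most `D`. -/
def HasDegreeLE (𝓕 : PolyFactor p n d) (D : ℕ) (P : (Fin n → ZMod p) → ZMod p) : Prop :=
  P ∈ Submodule.span (ZMod p) {m | ∃ e ≤ D, 𝓕.IsMonomial e m}

end PolyFactor

/-! The factor is regularised until its polynomials behave like independent variables: on cubes,
those derivatives of its basis polynomials that are not forced to vanish take every tuple of values
(`Unbiased.exists_Psi_eq`). Write P = B(basis values). The vanishing of (D+1)-fold derivatives of P
then becomes an identity for B on every formal cube (`CubeVanish`). Special cubes turn it into the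
vanishing of all unit-vector derivatives of B of weight above D, a coordinate of degree i having
weight i, and Newton's expansion exhibits B as a combination of monomials of weight at most D.

By Fourier inversion, equidistribution amounts to small exponential sums of linear forms in
derivatives. Gowers–Cauchy–Schwarz with a fixed base point (`norm_expect_DS_pow_le`) bounds these by
Gowers averages of nonzero combinations from the factor; a large average would force low rank
(`GowersRank`), which regularity excludes.

That inverse statement is proved by induction on the degree. `BiasRank` implies `GowersRank` in
degree k < p, because the k-fold derivative of P restricted to the diagonal is k!·P up to lower
degree. Conversely, a biased polynomial of degree d+1 agrees, off a small set, with a function of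
boundedly many of its derivatives (`exists_approx`). These have degree at most d, so the factor they
generate can be regularised by the induction hypothesis, and then agreement almost everywhere
upgrades to measurability everywhere (`Unbiased.agree_of_approx`).

Throughout, `Kill k` means degree less than k, so part `i : Fin d` of a factor satisfies `Kill (i +
2)`. The ambient group is arbitrary because the polarisation step passes from V to V × V^k. -/

open Finset
open scoped BigOperators

set_option linter.unusedSectionVars false

/-! ### Polynomials, derivatives along cubes, and rank -/

section Polynomials

variable {p : ℕ} {V : Type} [AddCommGroup V]

/-- `P` is annihilated by all `k`-fold additive derivatives. -/
def Kill : ℕ → (V → ZMod p) → Prop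
  | 0, P => P = 0
  | k + 1, P => ∀ h, Kill k (fwdDiff h P)

theorem kill_zero (k : ℕ) : Kill k (0 : V → ZMod p) := by
  induction k with
  | zero => rfl
  | succ k ih =>
    intro h
    have : fwdDiff h (0 : V → ZMod p) = 0 := by ext x; simp [fwdDiff]
    rw [this]; exact ih

theorem Kill.add {k : ℕ} {P Q : V → ZMod p} (hP : Kill k P) (hQ : Kill k Q) : Kill k (P + Q) := by
  induction k generalizing P Q with
  | zero => simp only [Kill] at *; simp [hP, hQ]
  | succ k ih => intro h; rw [fwdDiff_add]; exact ih (hP h) (hQ h)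

theorem Kill.smul {k : ℕ} {P : V → ZMod p} (c : ZMod p) (hP : Kill k P) : Kill k (c • P) := by
  induction k generalizing P with
  | zero => simp only [Kill] at *; simp [hP]
  | succ k ih => intro h; rw [fwdDiff_const_smul]; exact ih (hP h)

/-- Functions annihilated by all `k`-fold derivatives form a subspace. -/
def killSubmodule (p : ℕ) (V : Type) [AddCommGroup V] (k : ℕ) : Submodule (ZMod p) (V → ZMod p) where
  carrier := {P | Kill k P}
  add_mem' := Kill.add
  zero_mem' := kill_zero k
  smul_mem' := fun c _ h => Kill.smul c h

theorem mem_killSubmodule {k : ℕ} {P : V → ZMod p} : P ∈ killSubmodule p V k ↔ Kill k P := Iff.rfl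

theorem Kill.sum {k : ℕ} {ι : Type*} {s : Finset ι} {P : ι → V → ZMod p}
    (hP : ∀ i ∈ s, Kill k (P i)) : Kill k (∑ i ∈ s, P i) :=
  (killSubmodule p V k).sum_mem hP

theorem Kill.succ {k : ℕ} {P : V → ZMod p} (hP : Kill k P) : Kill (k + 1) P := by
  induction k generalizing P with
  | zero => simp only [Kill] at hP; subst hP; exact kill_zero 1
  | succ k ih => intro h; exact ih (hP h)

theorem Kill.mono {k l : ℕ} (hkl : k ≤ l) {P : V → ZMod p} (hP : Kill k P) : Kill l P := by
  induction hkl with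
  | refl => exact hP
  | step _ ih => exact ih.succ

theorem Kill.comp {W : Type} [AddCommGroup W] {k : ℕ} {P : V → ZMod p} (hP : Kill k P)
    (φ : W →+ V) (v : V) : Kill k (fun y => P (φ y + v)) := by
  induction k generalizing P with
  | zero => simp only [Kill] at *; subst hP; rfl
  | succ k ih =>
    intro h
    have : fwdDiff h (fun y => P (φ y + v)) = fun y => (fwdDiff (φ h) P) (φ y + v) := by
      ext y; simp only [fwdDiff, map_add]; congr 2; abel
    rw [this]; exact ih (hP _)

theorem Kill.comp_hom {W : Type} [AddCommGroup W] {k : ℕ} {P : V → ZMod p} (hP : Kill k P)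
    (φ : W →+ V) : Kill k (fun y => P (φ y)) := by
  simpa using hP.comp φ 0

theorem Kill.one_const {P : V → ZMod p} (hP : Kill 1 P) (x y : V) : P x = P y := by
  have h := congrFun (hP (y - x)) x
  simp only [fwdDiff, Pi.zero_apply] at h
  rw [show x + (y - x) = y by abel] at h
  exact (sub_eq_zero.mp h).symm

theorem isPolyOfDegreeLE_iff_kill {n : ℕ} (d : ℕ) (P : (Fin n → ZMod p) → ZMod p) :
    IsPolyOfDegreeLE d P ↔ Kill (d + 1) P := by
  have key : ∀ (k : ℕ) (P : (Fin n → ZMod p) → ZMod p),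
      (∀ l : List (Fin n → ZMod p), l.length = k → l.foldr fwdDiff P = 0) ↔ Kill k P := by
    intro k
    induction k with
    | zero => intro P; simp [Kill]
    | succ k ih =>
      intro P
      constructor
      · intro hP h
        rw [← ih]
        intro l hl
        have := hP (l ++ [h]) (by simp [hl])
        simpa using this
      · intro hP l hl
        obtain ⟨l', a, rfl⟩ : ∃ l' a, l = l' ++ [a] :=
          ⟨l.dropLast, l.getLast (by rintro rfl; simp at hl), (List.dropLast_append_getLast _).symm⟩
        have h0 := (ih _).mpr (hP a) l' (by simpa using hl)
        simpa using h0
  rw [← key]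
  constructor
  · intro h l hl
    have := h (fun i => l.get (i.cast hl.symm))
    rwa [← List.ofFn_congr hl, List.ofFn_get] at this
  · intro h l
    exact h _ (by simp)

/-- The iterated derivative `∏_{a ∈ S} Δ_{h a} P`. -/
def DS {ι : Type*} (h : ι → V) (S : Finset ι) (P : V → ZMod p) (x : V) : ZMod p :=
  ∑ T ∈ S.powerset, (-1) ^ (S.card - T.card) * P (x + ∑ a ∈ T, h a)

section DS

variable {ι : Type*}

@[simp] theorem DS_empty (h : ι → V) (P : V → ZMod p) (x : V) : DS h ∅ P x = P x := by
  simp [DS]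

theorem DS_insert [DecidableEq ι] (h : ι → V) {S : Finset ι} {a : ι} (ha : a ∉ S) (P : V → ZMod p) (x : V) :
    DS h (insert a S) P x = DS h S (fwdDiff (h a) P) x := by
  unfold DS
  rw [Finset.sum_powerset_insert ha, ← Finset.sum_add_distrib]
  refine Finset.sum_congr rfl fun T hT => ?_
  have hTS := Finset.mem_powerset.mp hT
  have haT : a ∉ T := fun h' => ha (hTS h')
  have hc := Finset.card_le_card hTS
  rw [Finset.card_insert_of_notMem ha, Finset.card_insert_of_notMem haT, Finset.sum_insert haT,
    show S.card + 1 - T.card = S.card - T.card + 1 by omega, Nat.add_sub_add_right, fwdDiff,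
    show x + (h a + ∑ b ∈ T, h b) = x + ∑ b ∈ T, h b + h a by abel]
  ring

theorem DS_add (h : ι → V) (S : Finset ι) (P Q : V → ZMod p) (x : V) :
    DS h S (P + Q) x = DS h S P x + DS h S Q x := by
  simp [DS, mul_add, Finset.sum_add_distrib]

theorem DS_sub (h : ι → V) (S : Finset ι) (P Q : V → ZMod p) (x : V) :
    DS h S (P - Q) x = DS h S P x - DS h S Q x := by
  simp [DS, mul_sub, Finset.sum_sub_distrib]

theorem DS_smul (h : ι → V) (S : Finset ι) (c : ZMod p) (P : V → ZMod p) (x : V) :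
    DS h S (c • P) x = c * DS h S P x := by
  simp only [DS, Pi.smul_apply, smul_eq_mul, Finset.mul_sum]
  exact Finset.sum_congr rfl fun _ _ => by ring

theorem DS_zero (h : ι → V) (S : Finset ι) (x : V) : DS h S (0 : V → ZMod p) x = 0 := by
  simp [DS]

theorem DS_sum {κ : Type*} (h : ι → V) (S : Finset ι) (s : Finset κ) (P : κ → V → ZMod p) (x : V) :
    DS h S (∑ i ∈ s, P i) x = ∑ i ∈ s, DS h S (P i) x := by
  classical
  induction s using Finset.induction with
  | empty => simp [DS_zero]
  | insert a s ha ih => rw [Finset.sum_insert ha, Finset.sum_insert ha, DS_add, ih]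

theorem DS_congr {h h' : ι → V} {S : Finset ι} (hh : ∀ a ∈ S, h a = h' a) (P : V → ZMod p) (x : V) :
    DS h S P x = DS h' S P x := by
  unfold DS
  refine Finset.sum_congr rfl fun T hT => ?_
  rw [Finset.sum_congr rfl fun a ha => hh a (Finset.mem_powerset.mp hT ha)]

theorem DS_update [DecidableEq ι] (h : ι → V) {S : Finset ι} {a : ι} (ha : a ∉ S) (v : V) (P : V → ZMod p) (x : V) :
    DS (Function.update h a v) S P x = DS h S P x :=
  DS_congr (fun _ hc => Function.update_of_ne (ne_of_mem_of_not_mem hc ha) _ _) P x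

theorem Kill.DS_eq_zero [DecidableEq ι] {k : ℕ} {P : V → ZMod p} (hP : Kill k P) (h : ι → V) {S : Finset ι}
    (hS : k ≤ S.card) (x : V) : DS h S P x = 0 := by
  induction S using Finset.induction generalizing k P with
  | empty =>
    simp only [Finset.card_empty, Nat.le_zero] at hS
    subst hS
    simp only [Kill] at hP
    simp [hP]
  | insert a S ha ih =>
    rw [DS_insert h ha]
    rw [Finset.card_insert_of_notMem ha] at hS
    cases k with
    | zero => exact ih (k := 0) (by simp only [Kill] at *; subst hP; ext; simp [fwdDiff]) (Nat.zero_le _)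
    | succ k => exact ih (hP (h a)) (by omega)

theorem apply_add_sum_eq_sum_DS [DecidableEq ι] (h : ι → V) (T : Finset ι) (P : V → ZMod p) (x : V) :
    P (x + ∑ a ∈ T, h a) = ∑ S ∈ T.powerset, DS h S P x := by
  induction T using Finset.induction generalizing P with
  | empty => simp
  | insert a T ha ih =>
    rw [Finset.sum_insert ha, Finset.sum_powerset_insert ha, ← ih]
    have : ∑ t ∈ T.powerset, DS h (insert a t) P x =
        ∑ t ∈ T.powerset, DS h t (fwdDiff (h a) P) x :=
      Finset.sum_congr rfl fun t ht => DS_insert h (fun h' => ha (Finset.mem_powerset.mp ht h')) P x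
    rw [this, ← ih, fwdDiff, show x + (h a + ∑ b ∈ T, h b) = x + ∑ b ∈ T, h b + h a by abel]
    ring

end DS

/-- Induction on m: Δ_{(m+1)h} = Δ_{mh} + Δ_h + Δ_{mh}Δ_h, and the last term lowers the degree by
two. -/
theorem kill_fwdDiff_nsmul_sub {k : ℕ} {P : V → ZMod p} (hP : Kill (k + 2) P) (m : ℕ) (h : V) :
    Kill k (fwdDiff (m • h) P - (m : ZMod p) • fwdDiff h P) := by
  induction m with
  | zero =>
    have : fwdDiff ((0 : ℕ) • h) P - ((0 : ℕ) : ZMod p) • fwdDiff h P = 0 := by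
      ext x; simp [fwdDiff]
    rw [this]; exact kill_zero k
  | succ m ih =>
    have : fwdDiff ((m + 1) • h) P - ((m + 1 : ℕ) : ZMod p) • fwdDiff h P =
        (fwdDiff (m • h) P - (m : ZMod p) • fwdDiff h P) + fwdDiff (m • h) (fwdDiff h P) := by
      ext x
      simp only [fwdDiff, Pi.sub_apply, Pi.add_apply, Pi.smul_apply, smul_eq_mul, add_smul, one_smul]
      rw [show x + (m • h + h) = x + m • h + h by abel]
      push_cast; ring
    rw [this]
    exact ih.add (hP h _)

/-- Up to lower degree, a polynomial of degree k is homogeneous of degree k. This evaluates its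
k-fold derivative on the diagonal. -/
theorem kill_comp_nsmul_sub {k : ℕ} {P : V → ZMod p} (hP : Kill (k + 1) P) (m : ℕ) :
    Kill k ((fun y => P (m • y)) - ((m : ZMod p) ^ k) • P) := by
  induction k generalizing P with
  | zero =>
    simp only [Kill]
    ext y
    simp [hP.one_const (m • y) y]
  | succ k ih =>
    intro h
    have : fwdDiff h ((fun y => P (m • y)) - ((m : ZMod p) ^ (k + 1)) • P) =
        (fun y => (fwdDiff (m • h) P - (m : ZMod p) • fwdDiff h P) (m • y)) +
          (m : ZMod p) • ((fun y => fwdDiff h P (m • y)) - ((m : ZMod p) ^ k) • fwdDiff h P) := by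
      ext y
      simp only [fwdDiff, Pi.sub_apply, Pi.add_apply, Pi.smul_apply, smul_eq_mul, smul_add]
      ring
    rw [this]
    refine Kill.add ?_ ((ih (hP h)).smul _)
    exact (kill_fwdDiff_nsmul_sub hP m h).comp_hom (nsmulAddMonoidHom m)

/-- `P` is a function of at most `r` functions annihilated by `k`-fold derivatives. -/
def RankLE (k r : ℕ) (P : V → ZMod p) : Prop :=
  ∃ s : Finset (V → ZMod p), s.card ≤ r ∧ (∀ q ∈ s, Kill k q) ∧
    ∀ x y, (∀ q ∈ s, q x = q y) → P x = P y

theorem RankLE.mono {k r r' : ℕ} (hr : r ≤ r') {P : V → ZMod p} (h : RankLE k r P) :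
    RankLE k r' P := by
  obtain ⟨s, hs, h1, h2⟩ := h
  exact ⟨s, hs.trans hr, h1, h2⟩

theorem RankLE.sub_kill {k r : ℕ} {P L : V → ZMod p} (h : RankLE k r P) (hL : Kill k L) :
    RankLE k (r + 1) (P - L) := by
  classical
  obtain ⟨s, hs, h1, h2⟩ := h
  refine ⟨insert L s, (Finset.card_insert_le _ _).trans (by omega), ?_, ?_⟩
  · intro q hq
    rcases Finset.mem_insert.mp hq with rfl | hq
    · exact hL
    · exact h1 q hq
  · intro x y hxy
    simp only [Pi.sub_apply]
    rw [h2 x y fun q hq => hxy q (Finset.mem_insert_of_mem hq), hxy L (Finset.mem_insert_self _ _)]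

theorem RankLE.smul {k r : ℕ} {P : V → ZMod p} (h : RankLE k r P) (c : ZMod p) :
    RankLE k r (c • P) := by
  obtain ⟨s, hs, h1, h2⟩ := h
  exact ⟨s, hs, h1, fun x y hxy => by simp [h2 x y hxy]⟩

theorem RankLE.comp_hom {W : Type} [AddCommGroup W] {k r : ℕ} {P : V → ZMod p} (h : RankLE k r P)
    (φ : W →+ V) : RankLE k r (fun y => P (φ y)) := by
  classical
  obtain ⟨s, hs, h1, h2⟩ := h
  refine ⟨s.image fun q y => q (φ y), Finset.card_image_le.trans hs, ?_, ?_⟩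
  · intro q hq
    obtain ⟨q', hq', rfl⟩ := Finset.mem_image.mp hq
    exact (h1 q' hq').comp_hom φ
  · intro x y hxy
    exact h2 _ _ fun q hq => hxy _ (Finset.mem_image_of_mem _ hq)

end Polynomials

/-! ### Averages and Jensen-type inequalities -/

section Averages

variable {α : Type*} [Fintype α]

theorem sq_norm_expect_le (f : α → ℂ) : ‖𝔼 x, f x‖ ^ 2 ≤ 𝔼 x, ‖f x‖ ^ 2 := by
  rcases isEmpty_or_nonempty α with h | h
  · simp
  have h1 : ‖𝔼 x, f x‖ ≤ 𝔼 x, ‖f x‖ := RCLike.norm_expect_le (K := ℂ)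
  have h2 := Finset.expect_mul_sq_le_sq_mul_sq Finset.univ (fun x => ‖f x‖) (fun _ => (1 : ℝ))
  simp only [mul_one, one_pow, Fintype.expect_const] at h2
  exact (pow_le_pow_left₀ (norm_nonneg _) h1 2).trans h2

theorem expect_pow_two_pow_le (n : ℕ) (f : α → ℝ) (hf : ∀ x, 0 ≤ f x) :
    (𝔼 x, f x) ^ 2 ^ n ≤ 𝔼 x, f x ^ 2 ^ n := by
  rcases isEmpty_or_nonempty α with h | h
  · simp
  induction n with
  | zero => simp
  | succ n ih =>
    have h2 := Finset.expect_mul_sq_le_sq_mul_sq Finset.univ (fun x => f x ^ 2 ^ n) (fun _ => (1 : ℝ))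
    simp only [mul_one, one_pow, Fintype.expect_const] at h2
    rw [pow_succ, pow_mul]
    simp only [pow_mul]
    exact (pow_le_pow_left₀ (pow_nonneg (Finset.expect_nonneg fun x _ => hf x) _) ih 2).trans h2

theorem re_expect (f : α → ℂ) : (𝔼 x, f x).re = 𝔼 x, (f x).re := by
  simp [Finset.expect, Complex.smul_re]

theorem expect_add_right {V M : Type*} [AddCommGroup V] [Fintype V] [AddCommMonoid M] [Module ℚ≥0 M]
    (f : V → M) (v : V) : 𝔼 x, f (x + v) = 𝔼 x, f x :=
  Fintype.expect_equiv (Equiv.addRight v) _ _ fun _ => rfl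

/-- Averaging over a function space can be done by resampling one coordinate. -/
theorem expect_update {ι V M : Type*} [Fintype ι] [DecidableEq ι] [Fintype V] [Nonempty V]
    [AddCommMonoid M] [Module ℚ≥0 M] (f : (ι → V) → M) (a : ι) :
    𝔼 h, f h = 𝔼 h : ι → V, 𝔼 v, f (Function.update h a v) := by
  have h1 : 𝔼 z : (ι → V) × V, f z.1 = 𝔼 z : (ι → V) × V, f (Function.update z.1 a z.2) :=
    (Fintype.expect_equiv
      { toFun := fun z => (Function.update z.1 a z.2, z.1 a)
        invFun := fun z => (Function.update z.1 a z.2, z.1 a)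
        left_inv := fun z => by simp
        right_inv := fun z => by simp } _ _ fun z => rfl).symm
  rw [← Finset.univ_product_univ, Finset.expect_product, Finset.expect_product] at h1
  simpa using h1

end Averages

/-! ### Characters, Gowers averages and Gowers–Cauchy–Schwarz -/

section ExpSums

variable {p : ℕ} [Fact p.Prime]

/-- The standard additive character of `ZMod p`. -/
noncomputable def ee (t : ZMod p) : ℂ := ZMod.stdAddChar t

theorem ee_zero : ee (0 : ZMod p) = 1 := AddChar.map_zero_eq_one _

theorem ee_add (s t : ZMod p) : ee (s + t) = ee s * ee t := AddChar.map_add_eq_mul _ _ _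

theorem norm_ee (t : ZMod p) : ‖ee t‖ = 1 := by
  exact Circle.norm_coe _

theorem ee_injective : Function.Injective (ee : ZMod p → ℂ) := ZMod.injective_stdAddChar

theorem conj_ee (t : ZMod p) : (starRingEnd ℂ) (ee t) = ee (-t) := by
  rw [ee, ee, AddChar.map_neg_eq_conj]

theorem ee_sub (s t : ZMod p) : ee (s - t) = ee s * (starRingEnd ℂ) (ee t) := by
  rw [sub_eq_add_neg, ee_add, conj_ee]

theorem expect_ee_mul (t : ZMod p) : 𝔼 c : ZMod p, ee (c * t) = if t = 0 then 1 else 0 := by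
  have h := AddChar.sum_mulShift t (ZMod.isPrimitive_stdAddChar p)
  rw [Fintype.expect_eq_sum_div_card]
  simp only [ee]
  rw [h]
  have : ((Fintype.card (ZMod p) : ℕ) : ℂ) ≠ 0 := by simp [(Fact.out : p.Prime).ne_zero]
  split_ifs <;> simp_all

/-- Orthogonality of characters on `ι → ZMod p`. -/
theorem expect_ee_dot {ι : Type*} [Fintype ι] [DecidableEq ι] (t : ι → ZMod p) :
    𝔼 μ : ι → ZMod p, ee (∑ i, μ i * t i) = if t = 0 then 1 else 0 := by
  have hee : ∀ (s : Finset ι) (f : ι → ZMod p), ee (∑ i ∈ s, f i) = ∏ i ∈ s, ee (f i) := by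
    intro s f
    induction s using Finset.induction with
    | empty => simp [ee_zero]
    | insert a s ha ih => rw [Finset.sum_insert ha, Finset.prod_insert ha, ee_add, ih]
  have h1 : ∏ i, 𝔼 c : ZMod p, ee (c * t i) = 𝔼 μ : ι → ZMod p, ee (∑ i, μ i * t i) := by
    simp only [hee, Fintype.expect_eq_sum_div_card]
    rw [Finset.prod_div_distrib, Finset.prod_univ_sum]
    simp
  rw [← h1]
  simp only [expect_ee_mul]
  split_ifs with h
  · subst h; simp
  · obtain ⟨i, hi⟩ := Function.ne_iff.mp h
    exact Finset.prod_eq_zero (Finset.mem_univ i) (if_neg hi)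

variable {V : Type} [AddCommGroup V] [Fintype V]

theorem sq_norm_expect_ee (Q : V → ZMod p) :
    ((‖𝔼 x, ee (Q x)‖ ^ 2 : ℝ) : ℂ) = 𝔼 k, 𝔼 x, ee (fwdDiff k Q x) := by
  push_cast
  rw [← Complex.mul_conj']
  have : (starRingEnd ℂ) (𝔼 x, ee (Q x)) = 𝔼 x, (starRingEnd ℂ) (ee (Q x)) := by
    simp [Finset.expect]
  rw [this, Finset.expect_mul_expect, Finset.expect_comm]
  rw [Finset.expect_comm (f := fun k x => ee (fwdDiff k Q x))]
  refine Finset.expect_congr rfl fun x _ => ?_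
  rw [← expect_add_right _ x]
  refine Finset.expect_congr rfl fun k _ => ?_
  rw [fwdDiff, ee_sub, add_comm]

/-- The `s`-th Gowers average `𝔼 ee (Δ_{k₁} ⋯ Δ_{k_s} Q)`. -/
noncomputable def U : ℕ → (V → ZMod p) → ℂ
  | 0, Q => 𝔼 x, ee (Q x)
  | s + 1, Q => 𝔼 k, U s (fwdDiff k Q)

theorem sq_norm_U_zero (Q : V → ZMod p) : ‖U 0 Q‖ ^ 2 = (U 1 Q).re := by
  have := congrArg Complex.re (sq_norm_expect_ee Q)
  rwa [Complex.ofReal_re] at this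

/-- Squaring the innermost average introduces one more difference; Cauchy–Schwarz carries the square
inside the outer averages. -/
theorem sq_norm_U_le (s : ℕ) (Q : V → ZMod p) : ‖U s Q‖ ^ 2 ≤ (U (s + 1) Q).re := by
  induction s generalizing Q with
  | zero => exact (sq_norm_U_zero Q).le
  | succ s ih =>
    calc ‖U (s + 1) Q‖ ^ 2 ≤ 𝔼 k, ‖U s (fwdDiff k Q)‖ ^ 2 := sq_norm_expect_le _
      _ ≤ 𝔼 k, (U (s + 1) (fwdDiff k Q)).re := Finset.expect_le_expect fun k _ => ih _
      _ = (U (s + 2) Q).re := (re_expect _).symm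

theorem norm_U_pow_le (s t : ℕ) (Q : V → ZMod p) : ‖U s Q‖ ^ 2 ^ t ≤ ‖U (s + t) Q‖ := by
  induction t with
  | zero => simp
  | succ t ih =>
    calc ‖U s Q‖ ^ 2 ^ (t + 1) = (‖U s Q‖ ^ 2 ^ t) ^ 2 := by rw [pow_succ, pow_mul]
      _ ≤ ‖U (s + t) Q‖ ^ 2 := by gcongr
      _ ≤ (U (s + t + 1) Q).re := sq_norm_U_le _ _
      _ ≤ _ := Complex.re_le_norm _

theorem norm_U_le_one (s : ℕ) (Q : V → ZMod p) : ‖U s Q‖ ≤ 1 := by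
  induction s generalizing Q with
  | zero =>
    refine (RCLike.norm_expect_le (K := ℂ)).trans ?_
    simp [norm_ee]
  | succ s ih =>
    refine (RCLike.norm_expect_le (K := ℂ)).trans ?_
    exact Finset.expect_le Finset.univ_nonempty fun k _ => ih _

theorem U_shift (s : ℕ) (Q : V → ZMod p) (v : V) : U s (fun y => Q (y + v)) = U s Q := by
  induction s generalizing Q with
  | zero => exact expect_add_right (fun y => ee (Q y)) v
  | succ s ih =>
    refine Finset.expect_congr rfl fun k _ => ?_
    rw [← ih (fwdDiff k Q)]
    congr 1
    ext y
    simp only [fwdDiff]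
    rw [add_right_comm]

variable {ι : Type} [Fintype ι] [DecidableEq ι]

theorem expect_DS_eq_U (S : Finset ι) (Q : V → ZMod p) :
    𝔼 h : ι → V, 𝔼 x, ee (DS h S Q x) = U S.card Q := by
  induction S using Finset.induction generalizing Q with
  | empty => simp [U]
  | insert a S ha ih =>
    rw [Finset.card_insert_of_notMem ha, U, expect_update _ a, Finset.expect_comm]
    refine Finset.expect_congr rfl fun v _ => ?_
    rw [← ih]
    refine Finset.expect_congr rfl fun h _ => Finset.expect_congr rfl fun x _ => ?_
    rw [DS_insert _ ha, DS_update _ ha, Function.update_self]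

/-- Gowers–Cauchy–Schwarz with a fixed base point: terms independent of one of the variables in `S`
do not help. -/
theorem norm_expect_DS_pow_le {S : Finset ι} (hS : S.Nonempty) (Q : V → ZMod p) (x : V)
    (b : ι → (ι → V) → ZMod p) (hb : ∀ a ∈ S, ∀ h v, b a (Function.update h a v) = b a h) :
    ‖𝔼 h : ι → V, ee (DS h S Q x + ∑ a ∈ S, b a h)‖ ^ 2 ^ S.card ≤ (U S.card Q).re := by
  have split : ∀ (a : ι) (g : (ι → V) → ZMod p) (β : (ι → V) → ZMod p),
      (∀ h v, β (Function.update h a v) = β h) →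
      ‖𝔼 h : ι → V, ee (β h + g h)‖ ≤ 𝔼 h : ι → V, ‖𝔼 v, ee (g (Function.update h a v))‖ := by
    intro a g β hβ
    rw [expect_update _ a]
    refine (RCLike.norm_expect_le (K := ℂ)).trans (le_of_eq ?_)
    refine Finset.expect_congr rfl fun h _ => ?_
    simp only [hβ, ee_add]
    rw [← Finset.mul_expect, norm_mul, norm_ee, one_mul]
  induction hS using Finset.Nonempty.cons_induction generalizing Q x b with
  | singleton a =>
    simp only [Finset.sum_singleton, Finset.card_singleton, pow_one, ← sq_norm_U_zero]
    gcongr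
    have := split a (fun h => DS h {a} Q x) (b a) (fun h v => hb a (by simp) h v)
    simp only [add_comm (b a _)] at this
    refine this.trans (le_of_eq ?_)
    have h1 : ∀ (h : ι → V) v, DS (Function.update h a v) {a} Q x = Q (v + x) - Q x := by
      intro h v
      rw [← insert_empty_eq, DS_insert _ (by simp)]
      simp [fwdDiff, add_comm]
    simp only [h1, ee_sub]
    simp only [← Finset.expect_mul, norm_mul, RCLike.norm_conj, norm_ee, mul_one]
    rw [expect_add_right (fun v => ee (Q v)) x, Fintype.expect_const]
    rfl
  | cons a S ha hS ih =>
    rw [Finset.cons_eq_insert] at *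
    rw [Finset.card_insert_of_notMem ha]
    -- Since `b a` ignores `h a`, it is a unimodular constant in the average over `h a` and drops
    -- out. Squaring what remains replaces `Q` by a difference of `Q`, and each other `b c` by a
    -- difference still independent of `h c`.
    set ρ : (ι → V) → ZMod p := fun h => DS h (insert a S) Q x + ∑ c ∈ S, b c h with hρ
    have h1 : ‖𝔼 h : ι → V, ee (DS h (insert a S) Q x + ∑ c ∈ insert a S, b c h)‖ ≤
        𝔼 h : ι → V, ‖𝔼 v, ee (ρ (Function.update h a v))‖ := by
      have := split a ρ (b a) (fun h v => hb a (by simp) h v)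
      have h0 : ∀ h, DS h (insert a S) Q x + ∑ c ∈ insert a S, b c h = b a h + ρ h := fun h => by
        rw [Finset.sum_insert ha, hρ]; ring
      simpa only [h0] using this
    have h2 : (𝔼 h : ι → V, ‖𝔼 v, ee (ρ (Function.update h a v))‖) ^ 2 ≤
        𝔼 h : ι → V, ‖𝔼 v, ee (ρ (Function.update h a v))‖ ^ 2 := by
      simpa using expect_pow_two_pow_le 1
        (fun h : ι → V => ‖𝔼 v, ee (ρ (Function.update h a v))‖) (fun _ => norm_nonneg _)
    have h3 : ∀ k v (h : ι → V), fwdDiff k (fun v => ρ (Function.update h a v)) v =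
        DS h S (fun y => fwdDiff k Q (y + v)) x +
          ∑ c ∈ S, (b c (Function.update h a (v + k)) - b c (Function.update h a v)) := by
      intro k v h
      simp only [fwdDiff, hρ]
      rw [DS_insert _ ha, DS_insert _ ha, DS_update _ ha, DS_update _ ha, Function.update_self,
        Function.update_self, Finset.sum_sub_distrib]
      have : DS h S (fwdDiff (v + k) Q) x - DS h S (fwdDiff v Q) x =
          DS h S (fun y => Q (y + v + k) - Q (y + v)) x := by
        rw [← DS_sub]; congr 1; ext y; simp only [Pi.sub_apply, fwdDiff, add_assoc]; ring
      rw [← this]; ring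
    have h4 : 𝔼 h : ι → V, ‖𝔼 v, ee (ρ (Function.update h a v))‖ ^ 2 =
        (𝔼 z : V × V, 𝔼 h : ι → V, ee (DS h S (fun y => fwdDiff z.1 Q (y + z.2)) x +
          ∑ c ∈ S, (b c (Function.update h a (z.2 + z.1)) - b c (Function.update h a z.2)))).re := by
      have h5 : ∀ h : ι → V, ‖𝔼 v, ee (ρ (Function.update h a v))‖ ^ 2 =
          (𝔼 z : V × V, ee (fwdDiff z.1 (fun v => ρ (Function.update h a v)) z.2)).re := by
        intro h
        have := congrArg Complex.re (sq_norm_expect_ee (fun v => ρ (Function.update h a v)))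
        rw [Complex.ofReal_re] at this
        rw [this, ← Finset.univ_product_univ, Finset.expect_product]
      simp only [h5]
      rw [← re_expect, Finset.expect_comm]
      simp only [h3]
    have h6 := (h2.trans_eq h4).trans ((Complex.re_le_norm _).trans (RCLike.norm_expect_le (K := ℂ)))
    calc _ = (‖𝔼 h : ι → V, ee (DS h (insert a S) Q x + ∑ c ∈ insert a S, b c h)‖ ^ 2) ^ 2 ^ S.card := by
          rw [← pow_mul, ← pow_succ']
      _ ≤ (𝔼 z : V × V, ‖𝔼 h : ι → V, ee (DS h S (fun y => fwdDiff z.1 Q (y + z.2)) x +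
          ∑ c ∈ S, (b c (Function.update h a (z.2 + z.1)) - b c (Function.update h a z.2)))‖) ^ 2 ^ S.card := by
          gcongr
          exact (pow_le_pow_left₀ (norm_nonneg _) h1 2).trans h6
      _ ≤ 𝔼 z : V × V, ‖𝔼 h : ι → V, ee (DS h S (fun y => fwdDiff z.1 Q (y + z.2)) x +
          ∑ c ∈ S, (b c (Function.update h a (z.2 + z.1)) - b c (Function.update h a z.2)))‖ ^ 2 ^ S.card :=
          expect_pow_two_pow_le _ _ fun _ => norm_nonneg _
      _ ≤ 𝔼 z : V × V, (U S.card (fun y => fwdDiff z.1 Q (y + z.2))).re := by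
          refine Finset.expect_le_expect fun z _ => ?_
          refine ih (fun y => fwdDiff z.1 Q (y + z.2)) x
            (fun c h => b c (Function.update h a (z.2 + z.1)) - b c (Function.update h a z.2)) ?_
          intro c hc h v
          have hca : c ≠ a := ne_of_mem_of_not_mem hc ha
          simp only [Function.update_comm hca, hb c (Finset.mem_insert_of_mem hc)]
      _ = (U (S.card + 1) Q).re := by
          simp only [U_shift]
          rw [U, re_expect, ← Finset.univ_product_univ, Finset.expect_product]
          simp

end ExpSums

/-! ### Factors as families of subspaces, and their regularisation -/

section Factors

variable {p : ℕ} [Fact p.Prime] {V : Type} [AddCommGroup V] {d : ℕ}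

/-- `W` is a factor given by subspaces: `W i` consists of polynomials of degree at most `i + 1`. -/
def IsFac (W : Fin d → Submodule (ZMod p) (V → ZMod p)) : Prop :=
  ∀ i, ∀ w ∈ W i, Kill ((i : ℕ) + 2) w

/-- The dimension of a factor given by subspaces. -/
noncomputable def fdim (W : Fin d → Submodule (ZMod p) (V → ZMod p)) : ℕ :=
  ∑ i, Module.finrank (ZMod p) (W i)

/-- `x` and `y` lie in the same atom of the factor `W`. -/
def Agree (W : Fin d → Submodule (ZMod p) (V → ZMod p)) (x y : V) : Prop :=
  ∀ i, ∀ w ∈ W i, w x = w y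

/-- Regularity of a factor given by subspaces, with growth function `G`. -/
def Reg (G : ℕ → ℕ) (W : Fin d → Submodule (ZMod p) (V → ZMod p)) : Prop :=
  ∀ i, ∀ w ∈ W i, w ≠ 0 → ¬ RankLE ((i : ℕ) + 1) (G (fdim W)) w

/-- The functions which agree at `x` and `y` form a subspace. -/
def agreeSubmodule (p : ℕ) {V : Type} (x y : V) : Submodule (ZMod p) (V → ZMod p) where
  carrier := {w | w x = w y}
  add_mem' := fun {a b} ha hb => by simp_all
  zero_mem' := rfl
  smul_mem' := fun c w h => by simp_all

/-- The factor whose only nonzero part is spanned by `s` and placed in degree `i`. -/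
def singleFac (d i : ℕ) (s : Set (V → ZMod p)) (j : Fin d) : Submodule (ZMod p) (V → ZMod p) :=
  if (j : ℕ) + 1 = i then Submodule.span (ZMod p) s else ⊥

theorem isFac_singleFac {i : ℕ} {s : Set (V → ZMod p)} (hs : ∀ q ∈ s, Kill (i + 1) q) :
    IsFac (singleFac d i s) := by
  intro j w hw
  unfold singleFac at hw
  split_ifs at hw with h
  · have : Submodule.span (ZMod p) s ≤ killSubmodule p V (i + 1) := Submodule.span_le.mpr hs
    have := this hw
    rw [mem_killSubmodule, ← h] at this
    exact this
  · rw [Submodule.mem_bot] at hw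
    subst hw
    exact kill_zero _

theorem Agree.of_singleFac {i : ℕ} (hi : i ≤ d) {s : Set (V → ZMod p)}
    (hs : ∀ q ∈ s, Kill (i + 1) q) {x y : V} (h : Agree (singleFac d i s) x y) :
    ∀ q ∈ s, q x = q y := by
  intro q hq
  cases i with
  -- A factor has no degree 0 part, but constants agree at any two points anyway.
  | zero => exact (hs q hq).one_const x y
  | succ i =>
    refine h ⟨i, hi⟩ q ?_
    simp only [singleFac, if_true]
    exact Submodule.subset_span hq

theorem finrank_singleFac_le [Fintype V] {i : ℕ} (s : Finset (V → ZMod p)) (j : Fin d) :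
    Module.finrank (ZMod p) (singleFac d i (s : Set (V → ZMod p)) j) ≤ s.card := by
  by_cases h : (j : ℕ) + 1 = i
  · rw [singleFac, if_pos h]
    exact finrank_span_finset_le_card (R := ZMod p) s
  · rw [singleFac, if_neg h, finrank_bot]
    exact Nat.zero_le _

/-- One step of the regularisation: a low rank element is replaced by polynomials of lower degree. -/
theorem IsFac.exists_reduction [Fintype V] {G : ℕ → ℕ}
    {W : Fin d → Submodule (ZMod p) (V → ZMod p)} (hW : IsFac W) (hreg : ¬ Reg G W) :
    ∃ W' : Fin d → Submodule (ZMod p) (V → ZMod p), IsFac W' ∧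
      (∀ x y, Agree W' x y → Agree W x y) ∧
      (∀ j, Module.finrank (ZMod p) (W' j) ≤ Module.finrank (ZMod p) (W j) + G (fdim W)) ∧
      Pi.Lex (· > ·) (fun {_} => (· < ·)) (fun j => Module.finrank (ZMod p) (W' j))
        (fun j => Module.finrank (ZMod p) (W j)) := by
  unfold Reg at hreg
  push Not at hreg
  obtain ⟨i, w, hwi, hw0, s, hs, hsk, hsw⟩ := hreg
  -- W i shrinks to a hyperplane complementary to `w`; the lower-degree polynomials that determine
  -- `w` go into the part just below.
  obtain ⟨C, hC⟩ := exists_isCompl (Submodule.span (ZMod p) {w})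
  have hle : Submodule.span (ZMod p) {w} ≤ W i := by
    rw [Submodule.span_singleton_le_iff_mem]; exact hwi
  set H := C ⊓ W i with hH
  have hsup : Submodule.span (ZMod p) {w} ⊔ H = W i := by
    rw [hH, ← sup_inf_assoc_of_le _ hle, hC.sup_eq_top, top_inf_eq]
  have hlt : H < W i := by
    refine lt_of_le_of_ne inf_le_right fun heq => hw0 ?_
    have h1 : w ∈ C := by
      have : w ∈ H := heq ▸ hwi
      exact this.1
    have := hC.inf_eq_bot ▸ Submodule.mem_inf.mpr ⟨Submodule.mem_span_singleton_self w, h1⟩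
    simpa using this
  have hsF := isFac_singleFac (d := d) (i := (i : ℕ)) (s := (s : Set (V → ZMod p))) hsk
  obtain ⟨W', hi, hj⟩ : ∃ W' : Fin d → Submodule (ZMod p) (V → ZMod p), W' i = H ∧
      ∀ j, j ≠ i → W' j = W j ⊔ singleFac d i s j :=
    ⟨fun j => if j = i then H else W j ⊔ singleFac d i s j, if_pos rfl, fun j h => if_neg h⟩
  refine ⟨W', ?_, ?_, ?_, ?_⟩
  · intro j v hv
    by_cases hji : j = i
    · subst hji
      rw [hi] at hv
      exact hW j v hv.2
    · rw [hj j hji] at hv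
      have : W j ⊔ singleFac d i s j ≤ killSubmodule p V ((j : ℕ) + 2) :=
        sup_le (hW j) (hsF j)
      exact this hv
  · intro x y hxy
    have h1 : Agree (singleFac d i (s : Set (V → ZMod p))) x y := by
      intro j v hv
      by_cases hji : j = i
      · subst hji
        have : v = 0 := by simpa [singleFac] using hv
        simp [this]
      · exact hxy j v ((hj j hji).symm ▸ Submodule.mem_sup_right hv)
    have h2 : w x = w y := hsw x y (h1.of_singleFac i.2.le hsk)
    intro j v hv
    by_cases hji : j = i
    · subst hji
      rw [← hsup] at hv
      have h3 : Submodule.span (ZMod p) {w} ⊔ H ≤ agreeSubmodule p x y := by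
        refine sup_le ?_ ?_
        · rw [Submodule.span_singleton_le_iff_mem]; exact h2
        · intro u hu
          exact hxy j u (hi.symm ▸ hu)
      exact h3 hv
    · exact hxy j v ((hj j hji).symm ▸ Submodule.mem_sup_left hv)
  · intro j
    by_cases hji : j = i
    · rw [hji, hi]
      exact (Submodule.finrank_mono hlt.le).trans (Nat.le_add_right _ _)
    · rw [hj j hji]
      refine (Submodule.finrank_add_le_finrank_add_finrank _ _).trans ?_
      exact Nat.add_le_add_left ((finrank_singleFac_le s j).trans hs) _
  -- Dimensions are compared from the highest degree down: parts above `i` are unchanged, part `i`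
  -- loses a dimension, and growth below is irrelevant.
  · refine ⟨i, ?_, ?_⟩
    · intro j hij
      have hji : j ≠ i := ne_of_gt hij
      have : singleFac d i (s : Set (V → ZMod p)) j = ⊥ := by
        unfold singleFac
        rw [if_neg]
        have : (i : ℕ) < j := hij
        omega
      dsimp only
      rw [hj j hji, this, sup_bot_eq]
    · dsimp only
      rw [hi]
      exact Submodule.finrank_lt_finrank_of_lt hlt

/-- Well-founded induction on the dimension vector, ordered lexicographically from the top degree.
One reduction leads to finitely many possible vectors, so a maximum over them gives a bound
independent of V. -/
theorem exists_regular_of_finrank (p : ℕ) [Fact p.Prime] (d : ℕ) (G : ℕ → ℕ) (M : Fin d → ℕ) :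
    ∃ C : ℕ, ∀ (V : Type) [AddCommGroup V] [Fintype V]
      (W : Fin d → Submodule (ZMod p) (V → ZMod p)), IsFac W →
      (fun i => Module.finrank (ZMod p) (W i)) = M →
      ∃ W' : Fin d → Submodule (ZMod p) (V → ZMod p), IsFac W' ∧ Reg G W' ∧
        (∀ x y, Agree W' x y → Agree W x y) ∧ fdim W' ≤ C := by
  have hwf : WellFounded (Pi.Lex (ι := Fin d) (β := fun _ => ℕ) (· > ·) (fun {_} => (· < ·))) :=
    Pi.Lex.wellFounded (ι := Fin d) (α := fun _ => ℕ) (· > ·) (s := fun _ => (· < ·))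
      (fun _ => wellFounded_lt)
  induction M using hwf.induction with
  | _ M ih =>
    choose! C hC using ih
    set S := Fintype.piFinset fun j => Finset.range (M j + G (∑ i, M i) + 1)
    refine ⟨max (∑ i, M i) (S.sup C), ?_⟩
    intro V _ _ W hW hM
    have hdim : fdim W = ∑ i, M i := by rw [← hM]; rfl
    by_cases hreg : Reg G W
    · exact ⟨W, hW, hreg, fun _ _ h => h, hdim ▸ le_max_left _ _⟩
    · obtain ⟨W₁, h1, h2, h3, h4⟩ := hW.exists_reduction hreg
      rw [hM] at h4
      obtain ⟨W', h5, h6, h7, h8⟩ := hC _ h4 V W₁ h1 rfl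
      refine ⟨W', h5, h6, fun x y h => h2 x y (h7 x y h), h8.trans ?_⟩
      refine le_trans ?_ (le_max_right _ _)
      refine Finset.le_sup (f := C) ?_
      rw [Fintype.mem_piFinset]
      intro j
      rw [Finset.mem_range, Nat.lt_succ_iff, ← hdim, ← hM]
      exact h3 j

/-- Regularity lemma. -/
theorem exists_regular (p : ℕ) [Fact p.Prime] (d : ℕ) (G : ℕ → ℕ) :
    ∃ C : ℕ → ℕ, ∀ (V : Type) [AddCommGroup V] [Fintype V]
      (W : Fin d → Submodule (ZMod p) (V → ZMod p)) (m : ℕ), IsFac W → fdim W ≤ m →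
      ∃ W' : Fin d → Submodule (ZMod p) (V → ZMod p), IsFac W' ∧ Reg G W' ∧
        (∀ x y, Agree W' x y → Agree W x y) ∧ fdim W' ≤ C m := by
  choose C hC using exists_regular_of_finrank p d G
  refine ⟨fun m => (Fintype.piFinset fun _ : Fin d => Finset.range (m + 1)).sup C, ?_⟩
  intro V _ _ W m hW hm
  obtain ⟨W', h1, h2, h3, h4⟩ := hC _ V W hW rfl
  refine ⟨W', h1, h2, h3, h4.trans (Finset.le_sup (f := C) ?_)⟩
  rw [Fintype.mem_piFinset]
  intro j
  rw [Finset.mem_range, Nat.lt_succ_iff]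
  exact (Finset.single_le_sum (f := fun i => Module.finrank (ZMod p) (W i))
    (fun _ _ => Nat.zero_le _) (Finset.mem_univ j)).trans hm

end Factors

/-! ### From bias to Gowers averages, and from high rank to small exponential sums -/

section BiasRank

/-- Biased polynomials of degree `k` have bounded rank. -/
def BiasRank (p k : ℕ) [Fact p.Prime] : Prop :=
  ∀ δ : ℝ, 0 < δ → ∃ r : ℕ, ∀ (V : Type) [AddCommGroup V] [Fintype V] (P : V → ZMod p),
    Kill (k + 1) P → δ ≤ ‖U 0 P‖ → RankLE k r P

/-- Polynomials of degree `k` with large `k`-th Gowers average have bounded rank. -/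
def GowersRank (p k : ℕ) [Fact p.Prime] : Prop :=
  ∀ δ : ℝ, 0 < δ → ∃ r : ℕ, ∀ (V : Type) [AddCommGroup V] [Fintype V] (P : V → ZMod p),
    Kill (k + 1) P → δ ≤ ‖U k P‖ → RankLE k r P

/-- The k-th finite difference of m ↦ m^k at 0, with the terms grouped by subsets. -/
theorem sum_powerset_neg_one_pow_mul_card_pow (p k : ℕ) :
    ∑ T ∈ (Finset.univ : Finset (Fin k)).powerset,
      (-1 : ZMod p) ^ (k - T.card) * (T.card : ZMod p) ^ k = (k.factorial : ZMod p) := by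
  have h1 := congrFun (fwdDiff_iter_eq_factorial (R := ZMod p) (n := k)) 0
  rw [fwdDiff_iter_eq_sum_shift] at h1
  rw [Finset.sum_powerset_apply_card (fun m => (-1 : ZMod p) ^ (k - m) * (m : ZMod p) ^ k)]
  rw [Finset.card_univ, Fintype.card_fin]
  refine Eq.trans ?_ h1
  refine Finset.sum_congr rfl fun m _ => ?_
  simp only [nsmul_eq_mul, zsmul_eq_mul]
  push_cast
  rw [zero_add, mul_one]
  ring

/-- The k-fold derivative of Q is itself a polynomial of degree k on V × V^k, with bias `U k Q`,
hence of bounded rank. Its diagonal restriction is k!·Q plus lower degree, and k! is invertible. -/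
theorem BiasRank.gowersRank {p k : ℕ} [Fact p.Prime] (hk : k < p) (h : BiasRank p k) :
    GowersRank p k := by
  intro δ hδ
  obtain ⟨r, hr⟩ := h δ hδ
  refine ⟨r + 1, ?_⟩
  intro V _ _ Q hQ hU
  set G : V × (Fin k → V) → ZMod p := fun z => DS z.2 Finset.univ Q z.1 with hG
  have hGk : Kill (k + 1) G := by
    have : G = ∑ T ∈ (Finset.univ : Finset (Fin k)).powerset,
        ((-1 : ZMod p) ^ ((Finset.univ : Finset (Fin k)).card - T.card)) •
          fun z : V × (Fin k → V) => Q (z.1 + ∑ a ∈ T, z.2 a) := by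
      ext z
      simp [hG, DS, Finset.sum_apply]
    rw [this]
    refine Kill.sum fun T _ => Kill.smul _ ?_
    have := hQ.comp_hom (AddMonoidHom.fst V (Fin k → V) +
      ∑ a ∈ T, (Pi.evalAddMonoidHom (fun _ : Fin k => V) a).comp (AddMonoidHom.snd V (Fin k → V)))
    simpa [AddMonoidHom.finsetSum_apply] using this
  have hU0 : U 0 G = U k Q := by
    have := expect_DS_eq_U (ι := Fin k) Finset.univ Q
    rw [Finset.card_univ, Fintype.card_fin] at this
    rw [← this, U, ← Finset.univ_product_univ, Finset.expect_product, Finset.expect_comm]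
  have h1 := hr _ G hGk (hU0 ▸ hU)
  -- Restriction to base point 0 with all k directions equal to y.
  have h2 := h1.comp_hom ((0 : V →+ V).prod (AddMonoidHom.pi fun _ : Fin k => AddMonoidHom.id V))
  set A : V → ZMod p := fun y => DS (fun _ : Fin k => y) Finset.univ Q 0 with hA
  have h3 : RankLE k r A := h2
  set L : V → ZMod p := ∑ T ∈ (Finset.univ : Finset (Fin k)).powerset,
    ((-1 : ZMod p) ^ (k - T.card)) •
      ((fun y => Q (T.card • y)) - ((T.card : ZMod p) ^ k) • Q) with hL
  have hLk : Kill k L := Kill.sum fun T _ => Kill.smul _ (kill_comp_nsmul_sub hQ _)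
  have hk0 : (k.factorial : ZMod p) ≠ 0 := by
    rw [Ne, ZMod.natCast_eq_zero_iff, (Fact.out : p.Prime).dvd_factorial]
    omega
  have hAL : A - L = (k.factorial : ZMod p) • Q := by
    ext y
    rw [← sum_powerset_neg_one_pow_mul_card_pow]
    simp only [hA, hL, DS, Pi.sub_apply, Finset.sum_apply, Pi.smul_apply, smul_eq_mul,
      Finset.sum_const, zero_add, Finset.card_univ, Fintype.card_fin, Finset.sum_mul]
    rw [← Finset.sum_sub_distrib]
    exact Finset.sum_congr rfl fun T _ => by ring
  have h4 := (h3.sub_kill hLk).smul (k.factorial : ZMod p)⁻¹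
  rwa [hAL, smul_smul, inv_mul_cancel₀ hk0, one_smul] at h4

/-- The nonzero component of highest degree dominates. Monotonicity raises `U s` to the Gowers
average of that degree, at the cost of a power of ε; if this is large, the sum has low rank, and
removing the lower-degree terms costs one more. -/
theorem exists_rank_forall_norm_U_le {p d : ℕ} [Fact p.Prime]
    (hG : ∀ i < d, GowersRank p (i + 1)) {ε : ℝ} (hε : 0 < ε) (hε1 : ε ≤ 1) :
    ∃ R : ℕ, ∀ (V : Type) [AddCommGroup V] [Fintype V]
      (W : Fin d → Submodule (ZMod p) (V → ZMod p)), IsFac W →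
      (∀ i, ∀ w ∈ W i, w ≠ 0 → ¬ RankLE ((i : ℕ) + 1) R w) →
      ∀ q : Fin d → V → ZMod p, (∀ i, q i ∈ W i) → q ≠ 0 →
      ∀ s : ℕ, (∀ i, q i ≠ 0 → s ≤ (i : ℕ) + 1) → ‖U s (∑ i, q i)‖ ≤ ε := by
  have h := fun i : Fin d => hG i i.2 (ε ^ 2 ^ ((i : ℕ) + 1)) (by positivity)
  choose r hr using h
  refine ⟨Finset.univ.sup r + 1, ?_⟩
  intro V _ _ W hW hreg q hq hq0 s hs
  obtain ⟨i₁, hi₁⟩ := Function.ne_iff.mp hq0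
  obtain ⟨i, hi, hmax⟩ := Finset.exists_max_image (Finset.univ.filter fun i => q i ≠ 0) id
    ⟨i₁, by simpa using hi₁⟩
  have hi0 : q i ≠ 0 := by simpa using hi
  have hmax' : ∀ j, q j ≠ 0 → j ≤ i := fun j hj => hmax j (by simpa using hj)
  set L : V → ZMod p := ∑ j ∈ Finset.univ.erase i, q j with hL
  have hsum : ∑ j, q j = q i + L := (Finset.add_sum_erase _ _ (Finset.mem_univ i)).symm
  have hLk : Kill ((i : ℕ) + 1) L := by
    refine Kill.sum fun j hj => ?_
    by_cases hj0 : q j = 0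
    · rw [hj0]; exact kill_zero _
    · have h1 : (j : ℕ) ≤ i := hmax' j hj0
      have h2 : (j : ℕ) ≠ i := fun h => (Finset.ne_of_mem_erase hj) (Fin.ext h)
      exact (hW j _ (hq j)).mono (by omega)
  have hQk : Kill ((i : ℕ) + 1 + 1) (∑ j, q j) := by
    rw [hsum]
    exact (hW i _ (hq i)).add hLk.succ
  by_contra hcon
  push Not at hcon
  have hsi := hs i hi0
  have h1 : ε ^ 2 ^ ((i : ℕ) + 1) ≤ ‖U ((i : ℕ) + 1) (∑ j, q j)‖ := by
    calc ε ^ 2 ^ ((i : ℕ) + 1) ≤ ε ^ 2 ^ ((i : ℕ) + 1 - s) :=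
          pow_le_pow_of_le_one hε.le hε1 (Nat.pow_le_pow_right (by norm_num) (Nat.sub_le _ _))
      _ ≤ ‖U s (∑ j, q j)‖ ^ 2 ^ ((i : ℕ) + 1 - s) := by gcongr
      _ ≤ ‖U (s + ((i : ℕ) + 1 - s)) (∑ j, q j)‖ := norm_U_pow_le _ _ _
      _ = _ := by rw [Nat.add_sub_cancel' hsi]
  have h2 := (hr i V _ hQk h1).sub_kill hLk
  rw [hsum, add_sub_cancel_right] at h2
  exact hreg i _ (hq i) hi0 (h2.mono (Nat.succ_le_succ (Finset.le_sup (Finset.mem_univ i))))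

variable {p d : ℕ} [Fact p.Prime] {V : Type} [AddCommGroup V] [Fintype V]
  {ι : Type} [Fintype ι] [DecidableEq ι]

/-- Take a nonempty active set S₀ of maximal size. Every other active S misses some element of S₀,
so its term ignores that direction and is harmless in Gowers–Cauchy–Schwarz applied to S₀. -/
theorem norm_expect_sum_DS_le {ε : ℝ} (hε : 0 ≤ ε) (Q : Finset ι → V → ZMod p)
    (nz : Finset ι → Prop) (hnz : ∀ S, ¬ nz S → Q S = 0)
    (hU : ∀ S, nz S → ‖U S.card (Q S)‖ ≤ ε ^ 2 ^ S.card) (hQ : ∃ S, S.Nonempty ∧ nz S)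
    (x : V) : ‖𝔼 h : ι → V, ee (∑ S, DS h S (Q S) x)‖ ≤ ε := by
  obtain ⟨S₁, hS₁, hQ₁⟩ := hQ
  classical
  obtain ⟨S₀, hS₀, hmax⟩ := Finset.exists_max_image
    (Finset.univ.filter fun S => S.Nonempty ∧ nz S) Finset.card ⟨S₁, by simp [hS₁, hQ₁]⟩
  obtain ⟨hne, hQ0⟩ : S₀.Nonempty ∧ nz S₀ := by simpa using hS₀
  have hc : ∀ S : Finset ι, ∃ c ∈ S₀, S ≠ S₀ → nz S → c ∉ S := by
    intro S
    by_cases hsub : S₀ ⊆ S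
    · obtain ⟨a, ha⟩ := hne
      refine ⟨a, ha, fun h1 h2 => absurd ?_ h1⟩
      exact (Finset.eq_of_subset_of_card_le hsub (hmax S (by simpa [h2] using ⟨a, hsub ha⟩))).symm
    · obtain ⟨a, ha, haS⟩ := Finset.not_subset.mp hsub
      exact ⟨a, ha, fun _ _ => haS⟩
  choose c hcS hc using hc
  set b : ι → (ι → V) → ZMod p := fun a h =>
    ∑ S ∈ (Finset.univ.erase S₀).filter (fun S => c S = a), DS h S (Q S) x with hb
  have h1 : ∀ h : ι → V, ∑ S, DS h S (Q S) x = DS h S₀ (Q S₀) x + ∑ a ∈ S₀, b a h := by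
    intro h
    rw [← Finset.add_sum_erase _ _ (Finset.mem_univ S₀), hb]
    congr 1
    exact (Finset.sum_fiberwise_of_maps_to (fun S _ => hcS S) _).symm
  have h2 := norm_expect_DS_pow_le hne (Q S₀) x b (by
    intro a _ h v
    refine Finset.sum_congr rfl fun S hS => ?_
    rw [Finset.mem_filter, Finset.mem_erase] at hS
    by_cases hQS : nz S
    · refine DS_update _ ?_ _ _ _
      rw [← hS.2]
      exact hc S hS.1.1 hQS
    · simp [hnz S hQS, DS_zero])
  simp only [h1]
  have h3 := h2.trans ((Complex.re_le_norm _).trans (hU S₀ hQ0))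
  exact (pow_le_pow_iff_left₀ (norm_nonneg _) hε (by positivity)).mp h3

end BiasRank

/-! ### Equidistribution of the derivatives of a regular factor -/

section Equidistribution

variable {p d : ℕ} [Fact p.Prime] {V : Type} [AddCommGroup V] [Fintype V]

/-- A basis of the degree `i + 1` part of a factor. -/
noncomputable def facBasis (W : Fin d → Submodule (ZMod p) (V → ZMod p)) (i : Fin d)
    (j : Fin (Module.finrank (ZMod p) (W i))) : V → ZMod p :=
  (Module.finBasis (ZMod p) (W i) j : W i)

theorem facBasis_mem (W : Fin d → Submodule (ZMod p) (V → ZMod p)) (i : Fin d)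
    (j : Fin (Module.finrank (ZMod p) (W i))) : facBasis W i j ∈ W i :=
  (Module.finBasis (ZMod p) (W i) j).2

theorem linearIndependent_facBasis (W : Fin d → Submodule (ZMod p) (V → ZMod p)) (i : Fin d) :
    LinearIndependent (ZMod p) (facBasis W i) :=
  (Module.finBasis (ZMod p) (W i)).linearIndependent.map' (W i).subtype (Submodule.ker_subtype _)

theorem span_facBasis (W : Fin d → Submodule (ZMod p) (V → ZMod p)) (i : Fin d) :
    Submodule.span (ZMod p) (Set.range (facBasis W i)) = W i := by
  have h := congrArg (Submodule.map (W i).subtype) (Module.finBasis (ZMod p) (W i)).span_eq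
  rw [Submodule.map_span, ← Set.range_comp, Submodule.map_top, Submodule.range_subtype] at h
  exact h

theorem agree_iff_facBasis {W : Fin d → Submodule (ZMod p) (V → ZMod p)} {x y : V} :
    Agree W x y ↔ ∀ i j, facBasis W i j x = facBasis W i j y := by
  refine ⟨fun h i j => h i _ (facBasis_mem W i j), fun h i w hw => ?_⟩
  have : W i ≤ agreeSubmodule p x y := by
    rw [← span_facBasis W i, Submodule.span_le]
    rintro _ ⟨j, rfl⟩
    exact h i j
  exact this hw

variable (ι : Type) [Fintype ι] [DecidableEq ι]

/-- Indices for the nontrivial derivatives of the polynomials of a factor. -/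
abbrev Conf (W : Fin d → Submodule (ZMod p) (V → ZMod p)) : Type :=
  {t : (Σ i : Fin d, Fin (Module.finrank (ZMod p) (W i))) × Finset ι // t.2.card ≤ (t.1.1 : ℕ) + 1}

theorem card_Conf_le (W : Fin d → Submodule (ZMod p) (V → ZMod p)) :
    Fintype.card (Conf ι W) ≤ fdim W * 2 ^ Fintype.card ι := by
  refine (Fintype.card_subtype_le _).trans (le_of_eq ?_)
  simp [fdim]

variable {ι}

/-- The values at `x` of the derivatives, in the directions `h`, of the polynomials of a factor. -/
noncomputable def Psi (W : Fin d → Submodule (ZMod p) (V → ZMod p)) (x : V) (h : ι → V)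
    (t : Conf ι W) : ZMod p :=
  DS h t.1.2 (facBasis W t.1.1.1 t.1.1.2) x

/-- The component of a linear form on configurations in the directions `S` and degree `i + 1`. -/
noncomputable def component (W : Fin d → Submodule (ZMod p) (V → ZMod p)) (μ : Conf ι W → ZMod p)
    (S : Finset ι) (i : Fin d) : V → ZMod p :=
  ∑ j, (if h : S.card ≤ (i : ℕ) + 1 then μ ⟨(⟨i, j⟩, S), h⟩ else 0) • facBasis W i j

theorem component_mem (W : Fin d → Submodule (ZMod p) (V → ZMod p)) (μ : Conf ι W → ZMod p)
    (S : Finset ι) (i : Fin d) : component W μ S i ∈ W i :=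
  Submodule.sum_mem _ fun j _ => Submodule.smul_mem _ _ (facBasis_mem W i j)

theorem card_le_of_component_ne_zero {W : Fin d → Submodule (ZMod p) (V → ZMod p)}
    {μ : Conf ι W → ZMod p} {S : Finset ι} {i : Fin d} (h : component W μ S i ≠ 0) :
    S.card ≤ (i : ℕ) + 1 := by
  by_contra hS
  exact h (by simp [component, hS])

theorem component_ne_zero {W : Fin d → Submodule (ZMod p) (V → ZMod p)}
    {μ : Conf ι W → ZMod p} {t : Conf ι W} (h : μ t ≠ 0) : component W μ t.1.2 t.1.1.1 ≠ 0 := by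
  obtain ⟨⟨⟨i, j⟩, S⟩, hS⟩ := t
  intro h0
  have := Fintype.linearIndependent_iff.mp (linearIndependent_facBasis W i) _ h0 j
  simp only at hS
  rw [dif_pos hS] at this
  exact h this

theorem sum_subtype_eq_sum_dite {α M : Type*} [Fintype α] [AddCommMonoid M] {P : α → Prop}
    [DecidablePred P] (f : {a // P a} → M) :
    ∑ t, f t = ∑ a, if h : P a then f ⟨a, h⟩ else 0 := by
  symm
  rw [← Finset.sum_filter_of_ne (p := P), Finset.sum_subtype _ (p := P) (by simp)]
  · exact Finset.sum_congr rfl fun t _ => dif_pos t.2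
  · intro a _ ha
    by_contra h0
    exact ha (dif_neg h0)

theorem sum_mul_Psi (W : Fin d → Submodule (ZMod p) (V → ZMod p)) (μ : Conf ι W → ZMod p) (x : V)
    (h : ι → V) : ∑ t, μ t * Psi W x h t = ∑ S, DS h S (∑ i, component W μ S i) x := by
  have h1 : ∑ t : Conf ι W, μ t * Psi W x h t =
      ∑ z : (Σ i : Fin d, Fin (Module.finrank (ZMod p) (W i))) × Finset ι,
        if hz : z.2.card ≤ (z.1.1 : ℕ) + 1 then μ ⟨z, hz⟩ * Psi W x h ⟨z, hz⟩ else 0 :=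
    sum_subtype_eq_sum_dite _
  rw [h1, Fintype.sum_prod_type_right]
  refine Finset.sum_congr rfl fun S _ => ?_
  rw [Fintype.sum_sigma, DS_sum]
  refine Finset.sum_congr rfl fun i _ => ?_
  rw [component, DS_sum]
  refine Finset.sum_congr rfl fun j _ => ?_
  rw [DS_smul]
  dsimp only
  split_ifs
  · rfl
  · simp

/-- Linear forms in the derivatives of a regular factor are unbiased. -/
def Unbiased (ι : Type) [Fintype ι] [DecidableEq ι] (ε : ℝ)
    (W : Fin d → Submodule (ZMod p) (V → ZMod p)) : Prop :=
  (∀ μ : Conf ι W → ZMod p, (∃ t : Conf ι W, t.1.2.Nonempty ∧ μ t ≠ 0) → ∀ x,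
      ‖𝔼 h : ι → V, ee (∑ t, μ t * Psi W x h t)‖ ≤ ε) ∧
    ∀ μ : Conf ι W → ZMod p, μ ≠ 0 → ‖𝔼 x, 𝔼 h : ι → V, ee (∑ t, μ t * Psi W x h t)‖ ≤ ε

/-- Grouping by direction sets writes a linear form as a sum of terms `DS h S (Q S)`. If some
nonempty S is active, the fixed-base-point bound applies; otherwise only S = ∅ survives and the
average is `U 0` of a nonzero combination. The power of ε absorbs the 2^|S|-th root. -/
theorem exists_rank_unbiased {p d : ℕ} [Fact p.Prime]
    (hG : ∀ i < d, GowersRank p (i + 1)) (ι : Type) [Fintype ι] [DecidableEq ι] {ε : ℝ}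
    (hε : 0 < ε) (hε1 : ε ≤ 1) :
    ∃ R : ℕ, ∀ (V : Type) [AddCommGroup V] [Fintype V]
      (W : Fin d → Submodule (ZMod p) (V → ZMod p)), IsFac W →
      (∀ i, ∀ w ∈ W i, w ≠ 0 → ¬ RankLE ((i : ℕ) + 1) R w) → Unbiased ι ε W := by
  obtain ⟨R, hR⟩ := exists_rank_forall_norm_U_le hG (ε := ε ^ 2 ^ Fintype.card ι) (by positivity)
    (pow_le_one₀ hε.le hε1)
  refine ⟨R, ?_⟩
  intro V _ _ W hW hreg
  have hU : ∀ (μ : Conf ι W → ZMod p) (S : Finset ι), component W μ S ≠ 0 →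
      ‖U S.card (∑ i, component W μ S i)‖ ≤ ε ^ 2 ^ S.card := by
    intro μ S hS
    refine (hR V W hW hreg _ (component_mem W μ S) hS S.card
      fun i hi => card_le_of_component_ne_zero hi).trans ?_
    exact pow_le_pow_of_le_one hε.le hε1
      (Nat.pow_le_pow_right (by norm_num) (Finset.card_le_univ S))
  have ha : ∀ μ : Conf ι W → ZMod p, (∃ t : Conf ι W, t.1.2.Nonempty ∧ μ t ≠ 0) → ∀ x,
      ‖𝔼 h : ι → V, ee (∑ t, μ t * Psi W x h t)‖ ≤ ε := by
    rintro μ ⟨t, ht, hμ⟩ x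
    simp only [sum_mul_Psi]
    refine norm_expect_sum_DS_le hε.le (fun S => ∑ i, component W μ S i)
      (fun S => component W μ S ≠ 0) ?_ (hU μ) ⟨t.1.2, ht, ?_⟩ x
    · intro S hS
      rw [not_not] at hS
      simp [hS]
    · exact fun h => component_ne_zero hμ (congrFun h _)
  refine ⟨ha, fun μ hμ => ?_⟩
  by_cases h : ∃ t : Conf ι W, t.1.2.Nonempty ∧ μ t ≠ 0
  · refine (RCLike.norm_expect_le (K := ℂ)).trans ?_
    exact Finset.expect_le Finset.univ_nonempty fun x _ => ha μ h x
  · push Not at h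
    obtain ⟨t, ht⟩ := Function.ne_iff.mp hμ
    have ht0 : t.1.2 = ∅ := by
      by_contra hne
      exact ht (h t (Finset.nonempty_iff_ne_empty.mpr hne))
    have hcomp : ∀ S : Finset ι, S ≠ ∅ → component W μ S = 0 := by
      intro S hS
      ext i x
      simp only [component, Finset.sum_apply, Pi.zero_apply, Pi.smul_apply]
      refine Finset.sum_eq_zero fun j _ => ?_
      split_ifs with hc
      · rw [h ⟨(⟨i, j⟩, S), hc⟩ (Finset.nonempty_iff_ne_empty.mpr hS), zero_smul]
      · rw [zero_smul]
    have h1 : ∀ x (h : ι → V), ∑ t, μ t * Psi W x h t = (∑ i, component W μ ∅ i) x := by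
      intro x h
      rw [sum_mul_Psi, Finset.sum_eq_single ∅, DS_empty]
      · intro S _ hS
        simp [hcomp S hS, DS_zero]
      · simp
    simp only [h1, Fintype.expect_const]
    have := hU μ ∅ (fun h => component_ne_zero ht (by rw [ht0]; exact congrFun h _))
    simpa [U] using this

variable {W : Fin d → Submodule (ZMod p) (V → ZMod p)} {ε : ℝ}

/-- Fourier inversion on configurations. Frequencies involving a genuine derivative contribute at
most ε at each base point; the others see only the atom and cancel. -/
theorem Unbiased.norm_expect_sub_le (hW : Unbiased ι ε W) (hε : 0 ≤ ε) {x y : V} (hxy : Agree W x y)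
    (g : (Conf ι W → ZMod p) → ℂ) (hg : ∀ a, ‖g a‖ ≤ 1) :
    ‖𝔼 h : ι → V, g (Psi W x h) - 𝔼 h : ι → V, g (Psi W y h)‖ ≤
      Fintype.card (Conf ι W → ZMod p) * (2 * ε) := by
  have hE : ∀ μ : Conf ι W → ZMod p, ‖𝔼 h : ι → V, ee (∑ t, μ t * Psi W x h t) -
      𝔼 h : ι → V, ee (∑ t, μ t * Psi W y h t)‖ ≤ 2 * ε := by
    intro μ
    by_cases h : ∃ t : Conf ι W, t.1.2.Nonempty ∧ μ t ≠ 0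
    · refine (norm_sub_le _ _).trans ?_
      linarith [hW.1 μ h x, hW.1 μ h y]
    · push Not at h
      have : ∀ h : ι → V, ∑ t, μ t * Psi W x h t = ∑ t, μ t * Psi W y h t := by
        intro h'
        refine Finset.sum_congr rfl fun t _ => ?_
        rcases Finset.eq_empty_or_nonempty t.1.2 with h0 | h0
        · simp only [Psi, h0, DS_empty]
          rw [agree_iff_facBasis.mp hxy]
        · rw [h t h0, zero_mul, zero_mul]
      simp only [this, sub_self, norm_zero]
      positivity
  have hinv : ∀ z, 𝔼 h : ι → V, g (Psi W z h) = ∑ b, g b * 𝔼 μ : Conf ι W → ZMod p,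
      ee (-∑ t, μ t * b t) * 𝔼 h : ι → V, ee (∑ t, μ t * Psi W z h t) := by
    intro z
    have h1 : ∀ a, g a = ∑ b, g b * 𝔼 μ : Conf ι W → ZMod p, ee (∑ t, μ t * (a - b) t) := by
      intro a
      simp only [expect_ee_dot, sub_eq_zero]
      simp
    have h2 : ∀ h : ι → V, g (Psi W z h) = ∑ b, g b * 𝔼 μ : Conf ι W → ZMod p,
        ee (-∑ t, μ t * b t) * ee (∑ t, μ t * Psi W z h t) := by
      intro h
      rw [h1]
      refine Finset.sum_congr rfl fun b _ => ?_
      congr 1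
      refine Finset.expect_congr rfl fun μ _ => ?_
      rw [← ee_add]
      congr 1
      simp only [Pi.sub_apply, mul_sub, Finset.sum_sub_distrib]
      ring
    simp only [h2]
    rw [Finset.expect_sum_comm]
    refine Finset.sum_congr rfl fun b _ => ?_
    rw [← Finset.mul_expect, Finset.expect_comm]
    simp only [Finset.mul_expect]
  rw [hinv, hinv, ← Finset.sum_sub_distrib]
  refine (norm_sum_le _ _).trans ?_
  rw [← nsmul_eq_mul, ← Finset.card_univ]
  refine Finset.sum_le_card_nsmul _ _ _ fun b _ => ?_
  rw [← mul_sub, norm_mul, ← Finset.expect_sub_distrib]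
  refine (mul_le_of_le_one_left (norm_nonneg _) (hg b)).trans ?_
  refine (RCLike.norm_expect_le (K := ℂ)).trans ?_
  refine Finset.expect_le Finset.univ_nonempty fun μ _ => ?_
  rw [← mul_sub, norm_mul, norm_ee, one_mul]
  exact hE μ

/-- If `a` were missed, orthogonality would make the Fourier sum at `a` vanish, yet frequency 0
contributes 1 and all the others together less than 1. -/
theorem Unbiased.exists_Psi_eq (hW : Unbiased ι ε W)
    (hε : Fintype.card (Conf ι W → ZMod p) * ε < 1) (hε0 : 0 ≤ ε) (a : Conf ι W → ZMod p) :
    ∃ x, ∃ h : ι → V, Psi W x h = a := by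
  by_contra hcon
  push Not at hcon
  have h1 : ∑ μ : Conf ι W → ZMod p,
      ee (-∑ t, μ t * a t) * 𝔼 x, 𝔼 h : ι → V, ee (∑ t, μ t * Psi W x h t) = 0 := by
    simp only [Finset.mul_expect]
    rw [← Finset.expect_sum_comm]
    refine Finset.expect_eq_zero fun x _ => ?_
    rw [← Finset.expect_sum_comm]
    refine Finset.expect_eq_zero fun h _ => ?_
    have h2 := expect_ee_dot (Psi W x h - a)
    rw [if_neg (sub_ne_zero.mpr (hcon x h)), Fintype.expect_eq_sum_div_card, div_eq_zero_iff,
      or_iff_left (by exact_mod_cast Fintype.card_ne_zero)] at h2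
    rw [← h2]
    refine Finset.sum_congr rfl fun μ _ => ?_
    rw [← ee_add]
    congr 1
    simp only [Pi.sub_apply, mul_sub, Finset.sum_sub_distrib]
    ring
  rw [← Finset.add_sum_erase _ _ (Finset.mem_univ (0 : Conf ι W → ZMod p))] at h1
  have h3 : ‖∑ μ ∈ Finset.univ.erase (0 : Conf ι W → ZMod p),
      ee (-∑ t, μ t * a t) * 𝔼 x, 𝔼 h : ι → V, ee (∑ t, μ t * Psi W x h t)‖ ≤
      Fintype.card (Conf ι W → ZMod p) * ε := by
    refine (norm_sum_le _ _).trans ?_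
    refine (Finset.sum_le_card_nsmul _ _ ε fun μ hμ => ?_).trans ?_
    · rw [norm_mul, norm_ee, one_mul]
      exact hW.2 μ (Finset.ne_of_mem_erase hμ)
    · rw [nsmul_eq_mul]
      gcongr
      exact Finset.card_le_univ _
  rw [eq_neg_of_add_eq_zero_right h1] at h3
  have h4 : ee (-∑ t, (0 : Conf ι W → ZMod p) t * a t) *
      𝔼 x, 𝔼 h : ι → V, ee (∑ t, (0 : Conf ι W → ZMod p) t * Psi W x h t) = 1 := by
    simp [ee_zero]
  rw [h4, norm_neg, norm_one] at h3
  linarith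

end Equidistribution

/-! ### Biased polynomials have bounded rank -/

section Inverse

variable {p d : ℕ} [Fact p.Prime] {V : Type} [AddCommGroup V] [Fintype V]

/-- A regular factor can be chosen so that linear forms in its derivatives are unbiased. -/
theorem exists_regular_unbiased (hG : ∀ i < d, GowersRank p (i + 1)) (ι : Type) [Fintype ι]
    [DecidableEq ι] (G : ℕ → ℕ) (ε : ℕ → ℝ) (hε : ∀ m, 0 < ε m) (hε1 : ∀ m, ε m ≤ 1) :
    ∃ C : ℕ → ℕ, ∀ (V : Type) [AddCommGroup V] [Fintype V]
      (W : Fin d → Submodule (ZMod p) (V → ZMod p)) (m : ℕ), IsFac W → fdim W ≤ m →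
      ∃ W' : Fin d → Submodule (ZMod p) (V → ZMod p), IsFac W' ∧ Reg G W' ∧
        Unbiased ι (ε (fdim W')) W' ∧ (∀ x y, Agree W' x y → Agree W x y) ∧ fdim W' ≤ C m := by
  choose R hR using fun m => exists_rank_unbiased hG ι (hε m) (hε1 m)
  obtain ⟨C, hC⟩ := exists_regular p d (fun m => max (G m) (R m))
  refine ⟨C, ?_⟩
  intro V _ _ W m hW hm
  obtain ⟨W', h1, h2, h3, h4⟩ := hC V W m hW hm
  refine ⟨W', h1, fun i w hw h0 hr => h2 i w hw h0 (hr.mono (le_max_left _ _)), ?_, h3, h4⟩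
  exact hR _ V W' h1 fun i w hw h0 hr => h2 i w hw h0 (hr.mono (le_max_right _ _))

/-- Second-moment method, one shift at a time: for a random new shift the cross term averages to
zero, so some shift adds at most 4. -/
theorem exists_sample (P : V → ZMod p) (k : ℕ) :
    ∃ h : Fin k → V, 𝔼 x, ‖∑ j, (ee (P (x + h j)) - U 0 P)‖ ^ 2 ≤ 4 * k := by
  set g : V → ℂ := fun x => ee (P x) - U 0 P with hg
  have hg0 : 𝔼 x, g x = 0 := by
    rw [hg, Finset.expect_sub_distrib, Fintype.expect_const, U, sub_self]
  have hg2 : ∀ x, ‖g x‖ ^ 2 ≤ 4 := by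
    intro x
    have h1 : ‖g x‖ ≤ 2 := by
      refine (norm_sub_le _ _).trans ?_
      rw [norm_ee]
      linarith [norm_U_le_one 0 P]
    nlinarith [norm_nonneg (g x)]
  induction k with
  | zero => exact ⟨Fin.elim0, by simp⟩
  | succ k ih =>
    obtain ⟨h, hh⟩ := ih
    set S : V → ℂ := fun x => ∑ j, (ee (P (x + h j)) - U 0 P) with hS
    have key : 𝔼 v, 𝔼 x, ‖g (x + v) + S x‖ ^ 2 ≤ 4 * (k + 1 : ℕ) := by
      have h1 : ∀ x, 𝔼 v, ‖g (x + v) + S x‖ ^ 2 = 𝔼 v, ‖g v‖ ^ 2 + ‖S x‖ ^ 2 := by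
        intro x
        have h2 : ∀ v, ‖g (x + v) + S x‖ ^ 2 = ‖g (v + x)‖ ^ 2 + ‖S x‖ ^ 2 +
            2 * (g (v + x) * (starRingEnd ℂ) (S x)).re := by
          intro v
          rw [add_comm x v, Complex.sq_norm, Complex.sq_norm, Complex.sq_norm, Complex.normSq_add]
        simp only [h2, Finset.expect_add_distrib, Fintype.expect_const]
        rw [← Finset.mul_expect, ← re_expect, ← Finset.expect_mul, expect_add_right g x, hg0,
          expect_add_right (fun v => ‖g v‖ ^ 2) x]
        simp
      rw [Finset.expect_comm]
      simp only [h1, Finset.expect_add_distrib, Fintype.expect_const]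
      have h3 : 𝔼 v, ‖g v‖ ^ 2 ≤ 4 := Finset.expect_le Finset.univ_nonempty fun x _ => hg2 x
      push_cast
      linarith
    obtain ⟨v, -, hv⟩ := Finset.exists_le_of_expect_le Finset.univ_nonempty key
    refine ⟨Fin.cons v h, ?_⟩
    simpa only [Fin.sum_univ_succ, Fin.cons_zero, Fin.cons_succ] using hv

theorem exists_separation (p : ℕ) [Fact p.Prime] :
    ∃ κ : ℝ, 0 < κ ∧ κ ≤ 2 ∧ ∀ s t : ZMod p, s ≠ t → κ ≤ ‖ee s - ee t‖ := by
  obtain ⟨z, hz, hmin⟩ := Finset.exists_min_image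
    (Finset.univ.filter fun z : ZMod p × ZMod p => z.1 ≠ z.2) (fun z => ‖ee z.1 - ee z.2‖)
    ⟨(0, 1), by simp⟩
  refine ⟨‖ee z.1 - ee z.2‖, ?_, ?_, fun s t hst => hmin (s, t) (by simpa using hst)⟩
  · rw [norm_pos_iff, sub_ne_zero]
    exact fun h => (by simpa using hz : z.1 ≠ z.2) (ee_injective h)
  · refine (norm_sub_le _ _).trans ?_
    rw [norm_ee, norm_ee]; norm_num

/-- A biased polynomial agrees almost everywhere with a function of boundedly many derivatives. -/
theorem exists_approx (p : ℕ) [Fact p.Prime] {δ σ : ℝ} (hδ : 0 < δ) (hσ : 0 < σ) :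
    ∃ k : ℕ, ∀ (V : Type) [AddCommGroup V] [Fintype V] (P : V → ZMod p), δ ≤ ‖U 0 P‖ →
      ∃ (h : Fin k → V) (c : V → ZMod p),
        (∀ x y, (∀ j, fwdDiff (h j) P x = fwdDiff (h j) P y) → c x = c y) ∧
        𝔼 x, (if c x ≠ P x then (1 : ℝ) else 0) ≤ σ := by
  obtain ⟨κ, hκ, hκ2, hsep⟩ := exists_separation p
  -- Small enough for unique decoding: two candidates would force κ(δ − η) < 2η, impossible as κ ≤
  -- 2.
  set η : ℝ := κ * δ / 4 with hη
  have hη0 : 0 < η := by positivity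
  -- Chebyshev: the failure probability is at most 4k/(kη)², which is then below σ.
  obtain ⟨k, hk⟩ := exists_nat_gt (4 / (σ * η ^ 2))
  have hk0 : (0 : ℝ) < k := lt_trans (by positivity) hk
  refine ⟨k, ?_⟩
  intro V _ _ P hP
  obtain ⟨h, hh⟩ := exists_sample P k
  set β := U 0 P with hβ
  set G : V → ℂ := fun x => ∑ j, ee (fwdDiff (h j) P x) with hGdef
  have hsum : ∀ x, ∑ j, (ee (P (x + h j)) - β) = ee (P x) * G x - k * β := by
    intro x
    rw [Finset.sum_sub_distrib, Finset.sum_const, Finset.card_univ, Fintype.card_fin,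
      nsmul_eq_mul, hGdef, Finset.mul_sum]
    congr 1
    refine Finset.sum_congr rfl fun j _ => ?_
    rw [← ee_add, fwdDiff]
    congr 1; ring
  simp only [hsum] at hh
  classical
  -- Multiplying `G x` by `ee (P x)` gives the sum of `ee (P (x + h j))`, close to kβ for most x. So
  -- `P x` is decoded as the t making `ee t * G x` close to kβ; the default 0 is used only when no t
  -- qualifies.
  set c : V → ZMod p := fun x =>
    if hc : ∃ t : ZMod p, ‖ee t * G x - k * β‖ < k * η then hc.choose else 0 with hc
  have huniq : ∀ x (s t : ZMod p), ‖ee s * G x - k * β‖ < k * η → ‖ee t * G x - k * β‖ < k * η → s = t := by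
    intro x s t hs ht
    by_contra hst
    have h1 : κ * ‖G x‖ < 2 * (k * η) := by
      calc κ * ‖G x‖ ≤ ‖ee s - ee t‖ * ‖G x‖ := by gcongr; exact hsep s t hst
        _ = ‖(ee s * G x - k * β) - (ee t * G x - k * β)‖ := by rw [← norm_mul]; congr 1; ring
        _ ≤ _ := norm_sub_le _ _
        _ < _ := by linarith
    have h2 : k * δ - k * η < ‖G x‖ := by
      have h3 : ‖(k : ℂ) * β‖ = k * ‖β‖ := by rw [norm_mul, Complex.norm_natCast]
      have h4 : ‖ee s * G x‖ = ‖G x‖ := by rw [norm_mul, norm_ee, one_mul]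
      have h5 := norm_sub_norm_le ((k : ℂ) * β) (ee s * G x)
      rw [norm_sub_rev, h3, h4] at h5
      have h6 : k * δ ≤ k * ‖β‖ := by gcongr
      linarith
    have h7 : κ * (k * δ - k * η) < 2 * (k * η) := lt_of_le_of_lt (by gcongr) h1
    have h8 : κ * (δ - η) < 2 * η := by
      by_contra h9
      push Not at h9
      nlinarith [mul_le_mul_of_nonneg_left h9 hk0.le]
    rw [hη] at h8
    have h10 : 0 ≤ κ * δ * (2 - κ) := mul_nonneg (by positivity) (by linarith)
    nlinarith
  refine ⟨h, c, ?_, ?_⟩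
  · intro x y hxy
    have : G x = G y := Finset.sum_congr rfl fun j _ => by rw [hxy j]
    simp only [hc, this]
  · have hpt : ∀ x, (if c x ≠ P x then (1 : ℝ) else 0) * (k * η) ^ 2 ≤
        ‖ee (P x) * G x - k * β‖ ^ 2 := by
      intro x
      split_ifs with hcx
      · rw [one_mul]
        gcongr
        by_contra hlt
        push Not at hlt
        have hex : ∃ t : ZMod p, ‖ee t * G x - k * β‖ < k * η := ⟨_, hlt⟩
        apply hcx
        simp only [hc, dif_pos hex]
        exact huniq x _ _ hex.choose_spec hlt
      · rw [zero_mul]; positivity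
    have h1 : (𝔼 x, (if c x ≠ P x then (1 : ℝ) else 0)) * (k * η) ^ 2 ≤ 4 * k := by
      rw [Finset.expect_mul]
      exact (Finset.expect_le_expect fun x _ => hpt x).trans hh
    rw [div_lt_iff₀ (by positivity)] at hk
    by_contra hcon
    push Not at hcon
    have h2 : σ * (k * η) ^ 2 < 4 * k :=
      lt_of_lt_of_le (mul_lt_mul_of_pos_right hcon (by positivity)) h1
    nlinarith

variable {ι : Type} [Fintype ι] [DecidableEq ι]

theorem expect_add_sum (f : V → ℝ) (x : V) {T : Finset ι} (hT : T.Nonempty) :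
    𝔼 h : ι → V, f (x + ∑ a ∈ T, h a) = 𝔼 y, f y := by
  obtain ⟨a, ha⟩ := hT
  rw [expect_update _ a]
  have : ∀ h : ι → V, 𝔼 v, f (x + ∑ b ∈ T, Function.update h a v b) = 𝔼 y, f y := by
    intro h
    rw [← expect_add_right f (x + ∑ b ∈ T.erase a, h b)]
    refine Finset.expect_congr rfl fun v _ => ?_
    rw [← Finset.add_sum_erase _ _ ha, Function.update_self,
      Finset.sum_congr rfl fun b hb => Function.update_of_ne (Finset.ne_of_mem_erase hb) v h]
    congr 1; abel
  simp only [this, Fintype.expect_const]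

/-- The value of the polynomials of a factor at the vertex `T` of a cube, in terms of their
derivatives at the base point. -/
def vertex {W : Fin d → Submodule (ZMod p) (V → ZMod p)} (a : Conf ι W → ZMod p) (T : Finset ι)
    (i : Fin d) (j : Fin (Module.finrank (ZMod p) (W i))) : ZMod p :=
  ∑ S ∈ T.powerset, if h : S.card ≤ (i : ℕ) + 1 then a ⟨(⟨i, j⟩, S), h⟩ else 0

theorem facBasis_apply_add_sum {W : Fin d → Submodule (ZMod p) (V → ZMod p)} (hW : IsFac W) (x : V)
    (h : ι → V) (T : Finset ι) (i : Fin d) (j : Fin (Module.finrank (ZMod p) (W i))) :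
    facBasis W i j (x + ∑ a ∈ T, h a) = vertex (Psi W x h) T i j := by
  rw [apply_add_sum_eq_sum_DS h T (facBasis W i j) x, vertex]
  refine Finset.sum_congr rfl fun S _ => ?_
  split_ifs with hS
  · rfl
  · exact (hW i _ (facBasis_mem W i j)).DS_eq_zero h (by omega) x

theorem exists_eq_comp_facBasis {W : Fin d → Submodule (ZMod p) (V → ZMod p)} {c : V → ZMod p}
    (hc : ∀ x y, Agree W x y → c x = c y) :
    ∃ B : ((i : Fin d) → Fin (Module.finrank (ZMod p) (W i)) → ZMod p) → ZMod p,
      ∀ x, c x = B fun i j => facBasis W i j x := by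
  have : Function.FactorsThrough c fun x i j => facBasis W i j x := by
    intro x y hxy
    exact hc x y (agree_iff_facBasis.mpr fun i j => congrFun (congrFun hxy i) j)
  obtain ⟨B, hB⟩ := (Function.factorsThrough_iff _).mp this
  exact ⟨B, fun x => congrFun hB x⟩

theorem rankLE_of_agree {W : Fin d → Submodule (ZMod p) (V → ZMod p)} (hW : IsFac W)
    {P : V → ZMod p} (hP : ∀ x y, Agree W x y → P x = P y) : RankLE (d + 1) (fdim W) P := by
  classical
  refine ⟨Finset.univ.image fun t : Σ i : Fin d, Fin (Module.finrank (ZMod p) (W i)) =>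
    facBasis W t.1 t.2, Finset.card_image_le.trans (by simp [fdim]), ?_, ?_⟩
  · intro q hq
    obtain ⟨t, -, rfl⟩ := Finset.mem_image.mp hq
    exact (hW t.1 _ (facBasis_mem W t.1 t.2)).mono (by omega)
  · intro x y hxy
    exact hP x y (agree_iff_facBasis.mpr fun i j =>
      hxy _ (Finset.mem_image.mpr ⟨⟨i, j⟩, Finset.mem_univ _, rfl⟩))

/-- A polynomial which is almost everywhere measurable with respect to an unbiased factor is
measurable. -/
theorem Unbiased.agree_of_approx {k : ℕ} {W : Fin d → Submodule (ZMod p) (V → ZMod p)} {ε : ℝ}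
    (hW : IsFac W) (hε : 0 ≤ ε) (hu : Unbiased (Fin k) ε W)
    (hN : Fintype.card (Conf (Fin k) W → ZMod p) * ε ≤ 1 / 8) {P c : V → ZMod p} (hP : Kill k P)
    (hc : ∀ x y, Agree W x y → c x = c y)
    (hcP : 2 ^ k * 𝔼 x, (if c x ≠ P x then (1 : ℝ) else 0) ≤ 1 / 8) {x y : V} (hxy : Agree W x y) :
    P x = P y := by
  obtain ⟨B, hB⟩ := exists_eq_comp_facBasis hc
  set 𝒯 := (Finset.univ : Finset (Fin k)).powerset.erase ∅ with h𝒯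
  -- The k-fold derivative of `P` vanishes, so the base value is a signed sum over the other
  -- vertices. `g` computes that sum with `c` in place of `P`. Each of these vertices is uniform, so
  -- a union bound makes `g` correct for most cubes at every base point.
  set g : (Conf (Fin k) W → ZMod p) → ZMod p := fun a =>
    -((-1) ^ k * ∑ T ∈ 𝒯, (-1) ^ (k - T.card) * B (vertex a T)) with hg
  have hcv : ∀ z (h : Fin k → V) T, B (vertex (Psi W z h) T) = c (z + ∑ a ∈ T, h a) := by
    intro z h T
    rw [hB]
    congr 1
    ext i j
    exact (facBasis_apply_add_sum hW z h T i j).symm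
  have hgood : ∀ z (h : Fin k → V), (∀ T ∈ 𝒯, c (z + ∑ a ∈ T, h a) = P (z + ∑ a ∈ T, h a)) →
      g (Psi W z h) = P z := by
    intro z h hz
    have h1 := hP.DS_eq_zero h (S := Finset.univ) (by simp) z
    rw [DS, ← Finset.add_sum_erase _ _ (Finset.empty_mem_powerset _)] at h1
    simp only [Finset.card_univ, Fintype.card_fin, Finset.card_empty, Nat.sub_zero,
      Finset.sum_empty, add_zero] at h1
    simp only [hg]
    rw [Finset.sum_congr rfl fun T hT => by rw [hcv, hz T hT], eq_neg_of_add_eq_zero_right h1,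
      mul_neg, neg_neg, ← mul_assoc, ← pow_add, ← two_mul, pow_mul]
    simp
  set b : V → (Fin k → V) → ℝ := fun z h => if g (Psi W z h) ≠ P z then 1 else 0 with hb
  have hbE : ∀ z, 𝔼 h, b z h ≤ 1 / 8 := by
    intro z
    have h1 : ∀ h : Fin k → V, b z h ≤ ∑ T ∈ 𝒯,
        (if c (z + ∑ a ∈ T, h a) ≠ P (z + ∑ a ∈ T, h a) then (1 : ℝ) else 0) := by
      intro h
      have hnn : ∀ T ∈ 𝒯, (0 : ℝ) ≤
          (if c (z + ∑ a ∈ T, h a) ≠ P (z + ∑ a ∈ T, h a) then (1 : ℝ) else 0) := by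
        intro T _; split_ifs <;> norm_num
      simp only [hb]
      split_ifs with hz
      · have : ∃ T ∈ 𝒯, c (z + ∑ a ∈ T, h a) ≠ P (z + ∑ a ∈ T, h a) := by
          by_contra hcon
          push Not at hcon
          exact hz (hgood z h hcon)
        obtain ⟨T, hT, hTc⟩ := this
        refine le_trans (le_of_eq ?_) (Finset.single_le_sum hnn hT)
        rw [if_pos hTc]
      · exact Finset.sum_nonneg hnn
    refine (Finset.expect_le_expect fun h _ => h1 h).trans ?_
    rw [Finset.expect_sum_comm]
    have h2 : ∀ T ∈ 𝒯, 𝔼 h : Fin k → V,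
        (if c (z + ∑ a ∈ T, h a) ≠ P (z + ∑ a ∈ T, h a) then (1 : ℝ) else 0) =
        𝔼 x, (if c x ≠ P x then (1 : ℝ) else 0) := fun T hT =>
      expect_add_sum (fun x => if c x ≠ P x then (1 : ℝ) else 0) z
        (Finset.nonempty_iff_ne_empty.mpr (Finset.ne_of_mem_erase hT))
    rw [Finset.sum_congr rfl h2, Finset.sum_const, nsmul_eq_mul]
    refine le_trans ?_ hcP
    have hE0 : 0 ≤ 𝔼 x, (if c x ≠ P x then (1 : ℝ) else 0) :=
      Finset.expect_nonneg fun x _ => by split_ifs <;> norm_num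
    gcongr
    have : 𝒯.card ≤ 2 ^ k := (Finset.card_erase_le).trans (by simp)
    exact_mod_cast this
  -- The value `P x` is predicted with probability at least 7/8 at `x` and at most 1/8 at `y`, while
  -- equidistribution allows a gap of at most 1/4.
  by_contra hne
  have h3 := hu.norm_expect_sub_le hε hxy (fun a => if g a = P x then 1 else 0) (by
    intro a; split_ifs <;> simp)
  have h4 := (Complex.re_le_norm _).trans h3
  rw [Complex.sub_re, re_expect, re_expect] at h4
  have h5 : 𝔼 h : Fin k → V, (1 - b x h) ≤
      𝔼 h : Fin k → V, (if g (Psi W x h) = P x then (1 : ℂ) else 0).re := by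
    refine Finset.expect_le_expect fun h _ => ?_
    by_cases hx : g (Psi W x h) = P x
    · simp [hb, hx]
    · simp [hb, hx]
  have h6 : 𝔼 h : Fin k → V, (if g (Psi W y h) = P x then (1 : ℂ) else 0).re ≤
      𝔼 h : Fin k → V, b y h := by
    refine Finset.expect_le_expect fun h _ => ?_
    by_cases hx : g (Psi W y h) = P x
    · simp [hb, hx, hne]
    · simp only [hb, if_neg hx, Complex.zero_re]
      split_ifs <;> norm_num
  rw [Finset.expect_sub_distrib, Fintype.expect_const] at h5
  linarith [hbE x, hbE y]

/-- An admissible quality of equidistribution for a factor of dimension `m`. -/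
noncomputable def tol (p k m : ℕ) : ℝ := 1 / (8 * (p : ℝ) ^ (m * 2 ^ k))

theorem tol_pos (p : ℕ) [Fact p.Prime] (k m : ℕ) : 0 < tol p k m := by
  have : (0 : ℝ) < p := by exact_mod_cast (Fact.out : p.Prime).pos
  unfold tol; positivity

theorem card_Conf_mul_tol_le (W : Fin d → Submodule (ZMod p) (V → ZMod p)) (k : ℕ) :
    Fintype.card (Conf (Fin k) W → ZMod p) * tol p k (fdim W) ≤ 1 / 8 := by
  have hp : (1 : ℝ) ≤ p := by exact_mod_cast (Fact.out : p.Prime).one_le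
  have h1 : (Fintype.card (Conf (Fin k) W → ZMod p) : ℝ) ≤ (p : ℝ) ^ (fdim W * 2 ^ k) := by
    rw [Fintype.card_fun, ZMod.card]
    push_cast
    refine pow_le_pow_right₀ hp ?_
    simpa using card_Conf_le (Fin k) W
  rw [tol, mul_one_div, div_le_div_iff₀ (by positivity) (by norm_num)]
  linarith

theorem tol_le_one (p : ℕ) [Fact p.Prime] (k m : ℕ) : tol p k m ≤ 1 := by
  have hp : (1 : ℝ) ≤ p := by exact_mod_cast (Fact.out : p.Prime).one_le
  have := one_le_pow₀ hp (n := m * 2 ^ k)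
  rw [tol, div_le_one (by positivity)]
  linarith

/-- The sampled derivatives have degree at most d, so they generate a factor of order d of bounded
dimension. After regularising it, P is measurable with respect to it, and a basis bounds the rank.
-/
theorem biasRank_succ (hG : ∀ i < d, GowersRank p (i + 1)) : BiasRank p (d + 1) := by
  intro δ hδ
  -- A union bound over the at most 2^(d+2) vertices of a cube must cost at most 1/8.
  obtain ⟨k, hk⟩ := exists_approx p hδ (σ := 1 / (8 * 2 ^ (d + 2))) (by positivity)
  obtain ⟨C, hC⟩ := exists_regular_unbiased hG (Fin (d + 2)) (fun _ => 0) (tol p (d + 2))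
    (tol_pos p _) (tol_le_one p _)
  refine ⟨C (d * k), ?_⟩
  intro V _ _ P hP hδP
  classical
  obtain ⟨h, c, hc, hcP⟩ := hk V P hδP
  set s : Finset (V → ZMod p) := Finset.univ.image fun j => fwdDiff (h j) P with hs
  have hsk : ∀ q ∈ (s : Set (V → ZMod p)), Kill (d + 1) q := by
    intro q hq
    obtain ⟨j, -, rfl⟩ := Finset.mem_image.mp (Finset.mem_coe.mp hq)
    exact hP (h j)
  have hdim : fdim (singleFac d d (s : Set (V → ZMod p))) ≤ d * k := by
    have hcard : s.card ≤ k := Finset.card_image_le.trans (by simp)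
    refine (Finset.sum_le_card_nsmul _ _ k fun j _ => (finrank_singleFac_le s j).trans hcard).trans ?_
    simp
  obtain ⟨W, hW, -, hu, href, hWd⟩ := hC V _ _ (isFac_singleFac hsk) hdim
  refine (rankLE_of_agree hW fun x y hxy => ?_).mono hWd
  refine hu.agree_of_approx (c := c) hW (tol_pos p _ _).le (card_Conf_mul_tol_le W _) hP ?_ ?_ hxy
  · intro x y hxy
    refine hc x y fun j => ?_
    exact (href x y hxy).of_singleFac le_rfl hsk _
      (Finset.mem_coe.mpr (Finset.mem_image_of_mem _ (Finset.mem_univ j)))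
  · calc _ ≤ 2 ^ (d + 2) * (1 / (8 * 2 ^ (d + 2)) : ℝ) := by gcongr
      _ = 1 / 8 := by field_simp

theorem biasRank_succ_of_lt (p d : ℕ) [Fact p.Prime] (hd : d < p) : BiasRank p (d + 1) := by
  induction d using Nat.strong_induction_on with
  | _ d ih => exact biasRank_succ fun i hi => (ih i hi (hi.trans hd)).gowersRank (by omega)

theorem gowersRank_succ {i : ℕ} (hi : i + 1 < p) : GowersRank p (i + 1) :=
  (biasRank_succ_of_lt p i (by omega)).gowersRank hi

end Inverse

/-! ### Newton expansion and identities on formal cubes -/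

section Newton

variable {p : ℕ} [Fact p.Prime] {τ : Type} [DecidableEq τ]

/-- The span of the monomials of weight at most `D`. -/
def weightedSpan (p : ℕ) {τ : Type} (wt : τ → ℕ) (D : ℕ) :
    Submodule (ZMod p) ((τ → ZMod p) → ZMod p) :=
  Submodule.span (ZMod p) {m | ∃ l : List τ, (l.map wt).sum ≤ D ∧ m = fun y => (l.map y).prod}

theorem weightedSpan_mono {wt : τ → ℕ} {D D' : ℕ} (h : D ≤ D') :
    weightedSpan p wt D ≤ weightedSpan p wt D' :=
  Submodule.span_mono fun _ ⟨l, hl, hm⟩ => ⟨l, hl.trans h, hm⟩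

theorem coord_mul_mem_weightedSpan {wt : τ → ℕ} {D : ℕ} {f : (τ → ZMod p) → ZMod p}
    (hf : f ∈ weightedSpan p wt D) (t : τ) :
    (fun y => y t * f y) ∈ weightedSpan p wt (D + wt t) := by
  induction hf using Submodule.span_induction with
  | mem f hf =>
    obtain ⟨l, hl, rfl⟩ := hf
    refine Submodule.subset_span ⟨t :: l, ?_, ?_⟩
    · simp only [List.map_cons, List.sum_cons]; omega
    · simp
  | zero =>
    convert Submodule.zero_mem _ using 1
    ext y; simp
  | add f g _ _ hf hg =>
    convert Submodule.add_mem _ hf hg using 1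
    ext y; simp [mul_add]
  | smul c f _ hf =>
    convert Submodule.smul_mem _ c hf using 1
    ext y; simp; ring

theorem coord_pow_mul_mem_weightedSpan {wt : τ → ℕ} {D : ℕ} {f : (τ → ZMod p) → ZMod p}
    (hf : f ∈ weightedSpan p wt D) (t : τ) (m : ℕ) :
    (fun y => y t ^ m * f y) ∈ weightedSpan p wt (D + m * wt t) := by
  induction m with
  | zero => simpa using hf
  | succ m ih =>
    have := coord_mul_mem_weightedSpan ih t
    rw [show D + (m + 1) * wt t = D + m * wt t + wt t by ring]
    convert this using 2
    ring

theorem eval_coord_mul_mem_weightedSpan {wt : τ → ℕ} {D k : ℕ} {f : (τ → ZMod p) → ZMod p}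
    (hf : f ∈ weightedSpan p wt D) (t : τ) {q : Polynomial (ZMod p)} (hq : q.natDegree ≤ k) :
    (fun y => q.eval (y t) * f y) ∈ weightedSpan p wt (D + k * wt t) := by
  have : (fun y : τ → ZMod p => q.eval (y t) * f y) =
      ∑ m ∈ Finset.range (k + 1), q.coeff m • fun y : τ → ZMod p => y t ^ m * f y := by
    ext y
    rw [Polynomial.eval_eq_sum_range' (Nat.lt_succ_of_le hq), Finset.sum_mul, Finset.sum_apply]
    exact Finset.sum_congr rfl fun m _ => by simp [mul_assoc]
  rw [this]
  refine Submodule.sum_mem _ fun m hm => Submodule.smul_mem _ _ ?_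
  refine weightedSpan_mono ?_ (coord_pow_mul_mem_weightedSpan hf t m)
  gcongr
  exact Nat.lt_succ_iff.mp (Finset.mem_range.mp hm)

theorem exists_polynomial_choose {k : ℕ} (hk : k < p) :
    ∃ q : Polynomial (ZMod p), q.natDegree ≤ k ∧ ∀ x : ZMod p, (x.val.choose k : ZMod p) = q.eval x := by
  have hk0 : (k.factorial : ZMod p) ≠ 0 := by
    rw [Ne, ZMod.natCast_eq_zero_iff, (Fact.out : p.Prime).dvd_factorial]
    omega
  refine ⟨Polynomial.C (k.factorial : ZMod p)⁻¹ * descPochhammer (ZMod p) k, ?_, fun x => ?_⟩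
  · refine (Polynomial.natDegree_C_mul_le _ _).trans ?_
    rw [descPochhammer_natDegree]
  · have h := descPochhammer_eval_eq_descFactorial (ZMod p) x.val k
    rw [ZMod.natCast_zmod_val] at h
    rw [Polynomial.eval_mul, Polynomial.eval_C, h, Nat.descFactorial_eq_factorial_mul_choose]
    push_cast
    rw [inv_mul_cancel_left₀ hk0]

/-- Iterated derivatives along unit vectors. -/
def unitDeriv (l : List τ) (B : (τ → ZMod p) → ZMod p) : (τ → ZMod p) → ZMod p :=
  l.foldl (fun B t => fwdDiff (Pi.single t 1) B) B

theorem unitDeriv_cons (t : τ) (l : List τ) (B : (τ → ZMod p) → ZMod p) :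
    unitDeriv (t :: l) B = unitDeriv l (fwdDiff (Pi.single t 1) B) := rfl

theorem unitDeriv_append (l l' : List τ) (B : (τ → ZMod p) → ZMod p) :
    unitDeriv (l ++ l') B = unitDeriv l' (unitDeriv l B) := by
  simp [unitDeriv]

theorem unitDeriv_replicate (t : τ) (k : ℕ) (B : (τ → ZMod p) → ZMod p) :
    unitDeriv (List.replicate k t) B = (fwdDiff (Pi.single t 1))^[k] B := by
  induction k generalizing B with
  | zero => rfl
  | succ k ih => rw [List.replicate_succ, unitDeriv_cons, ih, Function.iterate_succ_apply]

theorem unitDeriv_zero (l : List τ) : unitDeriv l (0 : (τ → ZMod p) → ZMod p) = 0 := by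
  induction l with
  | nil => rfl
  | cons t l ih =>
    rw [unitDeriv_cons]
    convert ih
    ext y; simp [fwdDiff]

theorem unitDeriv_comp_update {l : List τ} {t : τ} (ht : t ∉ l) (B : (τ → ZMod p) → ZMod p) :
    unitDeriv l (fun y => B (Function.update y t 0)) =
      fun y => unitDeriv l B (Function.update y t 0) := by
  induction l generalizing B with
  | nil => rfl
  | cons u l ih =>
    rw [List.mem_cons, not_or] at ht
    rw [unitDeriv_cons, unitDeriv_cons, ← ih ht.2]
    congr 1
    ext y
    simp only [fwdDiff]
    congr 2
    ext s
    by_cases hs : s = t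
    · subst hs; simp [ht.1]
    · simp [hs]

/-- A function whose derivatives of weight more than `D` vanish is a combination of monomials of
weight at most `D`. -/
theorem mem_weightedSpan_of_unitDeriv [Fintype τ] {wt : τ → ℕ} {D : ℕ} {B : (τ → ZMod p) → ZMod p}
    (hB : ∀ l : List τ, D < (l.map wt).sum → unitDeriv l B = 0) : B ∈ weightedSpan p wt D := by
  suffices H : ∀ (s : Finset τ) (D : ℕ) (B : (τ → ZMod p) → ZMod p),
      (∀ y y', (∀ t ∈ s, y t = y' t) → B y = B y') →
      (∀ l : List τ, (∀ t ∈ l, t ∈ s) → D < (l.map wt).sum → unitDeriv l B = 0) →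
      B ∈ weightedSpan p wt D from
    H Finset.univ D B (fun y y' h => congrArg B (funext fun t => h t (Finset.mem_univ t)))
      fun l _ => hB l
  intro s
  induction s using Finset.induction with
  | empty =>
    intro D B hconst _
    have : B = B 0 • fun y : τ → ZMod p => (([] : List τ).map y).prod := by
      ext y; simp [hconst y 0]
    rw [this]
    exact Submodule.smul_mem _ _ (Submodule.subset_span ⟨[], by simp, rfl⟩)
  | insert t s ht ih =>
    intro D B hdep hB
    set E : τ → ZMod p := Pi.single t 1 with hE
    set Bk : ℕ → (τ → ZMod p) → ZMod p := fun k y => (fwdDiff E)^[k] B (Function.update y t 0)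
      with hBk
    have hdep' : ∀ k y y', (∀ u ∈ insert t s, y u = y' u) →
        (fwdDiff E)^[k] B y = (fwdDiff E)^[k] B y' := by
      intro k
      induction k with
      | zero => exact hdep
      | succ k ihk =>
        intro y y' hy
        rw [Function.iterate_succ_apply', fwdDiff, fwdDiff, ihk y y' hy, ihk (y + E) (y' + E)]
        intro u hu
        simp [hy u hu]
    -- Newton's expansion in coordinate `t`. For k < p the binomial is a polynomial of degree at
    -- most k in `y t`, and the coefficient `Bk k` no longer depends on `y t`, with k · wt t less
    -- weight available.
    have hnewton : B = ∑ k ∈ Finset.range p, fun y => ((y t).val.choose k : ZMod p) * Bk k y := by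
      ext y
      have h1 := shift_eq_sum_fwdDiff_iter E B (y t).val (Function.update y t 0)
      have h2 : Function.update y t 0 + (y t).val • E = y := by
        ext u
        by_cases hu : u = t
        · subst hu
          rw [hE, Pi.add_apply, Function.update_self, Pi.smul_apply, Pi.single_eq_same,
            nsmul_eq_mul, mul_one, zero_add, ZMod.natCast_zmod_val]
        · simp [hE, hu]
      rw [h2] at h1
      rw [h1, Finset.sum_apply]
      have hlt : (y t).val + 1 ≤ p := ZMod.val_lt _
      rw [← Finset.sum_subset (Finset.range_mono hlt)]
      · exact Finset.sum_congr rfl fun k _ => by simp [hBk]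
      · intro k _ hk
        rw [Finset.mem_range, not_lt] at hk
        rw [Nat.choose_eq_zero_of_lt (by omega)]
        simp
    rw [hnewton]
    refine Submodule.sum_mem _ fun k hk => ?_
    obtain ⟨q, hq, hqe⟩ := exists_polynomial_choose (Finset.mem_range.mp hk)
    by_cases hkD : k * wt t ≤ D
    · have hmem : Bk k ∈ weightedSpan p wt (D - k * wt t) := by
        refine ih _ _ ?_ ?_
        · intro y y' hy
          refine hdep' k _ _ fun u hu => ?_
          by_cases hut : u = t
          · subst hut; simp
          · simp [hut, hy u ((Finset.mem_insert.mp hu).resolve_left hut)]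
        · intro l hl hlD
          have htl : t ∉ l := fun h => ht (hl t h)
          rw [hBk, unitDeriv_comp_update htl]
          have := hB (List.replicate k t ++ l) (by
            intro u hu
            rcases List.mem_append.mp hu with hu | hu
            · rw [List.eq_of_mem_replicate hu]; exact Finset.mem_insert_self _ _
            · exact Finset.mem_insert_of_mem (hl u hu)) (by
            simp only [List.map_append, List.map_replicate, List.sum_append, List.sum_replicate,
              smul_eq_mul]
            omega)
          rw [unitDeriv_append, unitDeriv_replicate] at this
          ext y
          exact congrFun this _
      have := eval_coord_mul_mem_weightedSpan hmem t hq
      rw [Nat.sub_add_cancel hkD] at this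
      simpa only [hqe] using this
    · have h0 : (fwdDiff E)^[k] B = 0 := by
        rw [← unitDeriv_replicate]
        refine hB _ (fun u hu => ?_) ?_
        · rw [List.eq_of_mem_replicate hu]; exact Finset.mem_insert_self _ _
        · simp only [List.map_replicate, List.sum_replicate, smul_eq_mul]
          omega
      have : (fun y : τ → ZMod p => ((y t).val.choose k : ZMod p) * Bk k y) = 0 := by
        ext y; simp [hBk, h0]
      rw [this]
      exact Submodule.zero_mem _

variable {κ : Type} [DecidableEq κ]

/-- For fixed T ∩ S₂, the signs over T ∩ S₁ sum to zero, so only the deviation f − g at the full S₁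
survives. -/
theorem sum_powerset_union_neg_one_pow {S₁ : Finset κ} (hS₁ : S₁.Nonempty) (S₂ : Finset κ)
    (hd : Disjoint S₁ S₂) (f g : Finset κ → ZMod p) :
    ∑ T ∈ (S₁ ∪ S₂).powerset, (-1) ^ T.card * (if S₁ ⊆ T then f (T ∩ S₂) else g (T ∩ S₂)) =
      (-1) ^ S₁.card * ∑ T ∈ S₂.powerset, (-1) ^ T.card * (f T - g T) := by
  induction hS₁ using Finset.Nonempty.cons_induction generalizing f with
  | singleton s =>
    have hs : s ∉ S₂ := Finset.disjoint_singleton_left.mp hd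
    rw [Finset.singleton_union, Finset.sum_powerset_insert hs, ← Finset.sum_add_distrib,
      Finset.mul_sum]
    refine Finset.sum_congr rfl fun T hT => ?_
    have hTS := Finset.mem_powerset.mp hT
    have hsT : s ∉ T := fun h => hs (hTS h)
    rw [if_neg (by simpa using hsT), if_pos (by simp), Finset.card_insert_of_notMem hsT,
      Finset.insert_inter_of_notMem hs, Finset.inter_eq_left.mpr hTS]
    simp; ring
  | cons s S₁ hs hne ih =>
    rw [Finset.cons_eq_insert] at *
    rw [Finset.disjoint_insert_left] at hd
    have hsu : s ∉ S₁ ∪ S₂ := by simp [hs, hd.1]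
    rw [Finset.insert_union, Finset.sum_powerset_insert hsu, Finset.card_insert_of_notMem hs]
    have h1 : ∑ T ∈ (S₁ ∪ S₂).powerset,
        (-1 : ZMod p) ^ T.card * (if insert s S₁ ⊆ T then f (T ∩ S₂) else g (T ∩ S₂)) = 0 := by
      have := ih hd.2 g
      simp only [ite_self, sub_self, mul_zero, Finset.sum_const_zero] at this
      rw [← this]
      refine Finset.sum_congr rfl fun T hT => ?_
      rw [if_neg]
      exact fun h => hsu (Finset.mem_powerset.mp hT (h (Finset.mem_insert_self _ _)))
    have h2 : ∑ T ∈ (S₁ ∪ S₂).powerset, (-1 : ZMod p) ^ (insert s T).card *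
        (if insert s S₁ ⊆ insert s T then f (insert s T ∩ S₂) else g (insert s T ∩ S₂)) =
        -∑ T ∈ (S₁ ∪ S₂).powerset,
          (-1 : ZMod p) ^ T.card * (if S₁ ⊆ T then f (T ∩ S₂) else g (T ∩ S₂)) := by
      rw [← Finset.sum_neg_distrib]
      refine Finset.sum_congr rfl fun T hT => ?_
      have hsT : s ∉ T := fun h => hsu (Finset.mem_powerset.mp hT h)
      simp only [Finset.card_insert_of_notMem hsT, Finset.insert_inter_of_notMem hd.1,
        Finset.insert_subset_insert_iff hs]
      ring
    rw [h1, h2, ih hd.2 f]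
    ring

/-- The alternating sum of `B` over every cube of admissible configurations vanishes. -/
def CubeVanish (wt : τ → ℕ) (S : Finset κ) (B : (τ → ZMod p) → ZMod p) : Prop :=
  ∀ a : Finset κ → τ → ZMod p, (∀ S' t, wt t < S'.card → a S' t = 0) →
    ∑ T ∈ S.powerset, (-1) ^ T.card * B (∑ S' ∈ T.powerset, a S') = 0

/-- Adding a unit vector to the configuration at index S₁, admissible since |S₁| ≤ wt t, shifts
exactly the vertices T ⊇ S₁. The alternating sum then collapses to that of the derivative over S₂.
-/
theorem CubeVanish.fwdDiff {wt : τ → ℕ} {S₁ S₂ : Finset κ} {B : (τ → ZMod p) → ZMod p}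
    (h : CubeVanish wt (S₁ ∪ S₂) B) (hS₁ : S₁.Nonempty) (hd : Disjoint S₁ S₂) {t : τ}
    (ht : S₁.card ≤ wt t) : CubeVanish wt S₂ (fwdDiff (Pi.single t 1) B) := by
  intro a ha
  set E : τ → ZMod p := Pi.single t 1 with hE
  set a' : Finset κ → τ → ZMod p := fun S' =>
    (if S' ⊆ S₂ then a S' else 0) + (if S' = S₁ then E else 0) with ha'
  have hsum : ∀ T : Finset κ, B (∑ S' ∈ T.powerset, a' S') =
      if S₁ ⊆ T then B (∑ S' ∈ (T ∩ S₂).powerset, a S' + E)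
        else B (∑ S' ∈ (T ∩ S₂).powerset, a S') := by
    intro T
    have h1 : T.powerset.filter (fun S' => S' ⊆ S₂) = (T ∩ S₂).powerset := by
      ext S'; simp only [Finset.mem_filter, Finset.mem_powerset, Finset.subset_inter_iff]
    rw [ha', Finset.sum_add_distrib, ← Finset.sum_filter, h1, Finset.sum_ite_eq']
    simp only [Finset.mem_powerset]
    split_ifs <;> simp
  have h1 := h a' (by
    intro S' u hu
    simp only [ha', Pi.add_apply]
    have h2 : (if S' ⊆ S₂ then a S' else 0) u = 0 := by
      split_ifs
      · exact ha S' u hu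
      · rfl
    have h3 : (if S' = S₁ then E else 0) u = 0 := by
      split_ifs with h
      · subst h
        have : u ≠ t := by rintro rfl; omega
        simp [hE, this]
      · rfl
    rw [h2, h3, add_zero])
  simp only [hsum] at h1
  rw [sum_powerset_union_neg_one_pow hS₁ S₂ hd (fun T => B (∑ S' ∈ T.powerset, a S' + E))
    (fun T => B (∑ S' ∈ T.powerset, a S'))] at h1
  exact (mul_eq_zero.mp h1).resolve_left (pow_ne_zero _ (neg_ne_zero.mpr one_ne_zero))

theorem CubeVanish.eq_zero {wt : τ → ℕ} {B : (τ → ZMod p) → ZMod p}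
    (h : CubeVanish wt (∅ : Finset κ) B) : B = 0 := by
  ext y
  have := h (fun S' => if S' = ∅ then y else 0) (by
    intro S' t ht
    have : S' ≠ ∅ := by rintro rfl; simp at ht
    simp [this])
  simpa using this

/-- A derivative in coordinate t consumes up to wt t directions of the cube. Once they are exhausted
the cube is a single arbitrary point, so the function is zero. -/
theorem CubeVanish.unitDeriv_eq_zero {wt : τ → ℕ} (hwt : ∀ t, 0 < wt t) {S : Finset κ}
    {B : (τ → ZMod p) → ZMod p} (h : CubeVanish wt S B) {l : List τ}
    (hl : S.card ≤ (l.map wt).sum) : unitDeriv l B = 0 := by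
  induction l generalizing S B with
  | nil =>
    have : S = ∅ := by simpa using hl
    subst this
    exact h.eq_zero
  | cons t l ih =>
    rcases Finset.eq_empty_or_nonempty S with rfl | hS
    · rw [h.eq_zero, unitDeriv_zero]
    · obtain ⟨S₁, hS₁, hcard⟩ := Finset.exists_subset_card_eq (Nat.min_le_left S.card (wt t))
      have hpos : 0 < S₁.card := by
        rw [hcard]; exact lt_min hS.card_pos (hwt t)
      rw [unitDeriv_cons]
      refine ih (S := S \ S₁) ?_ ?_
      · refine CubeVanish.fwdDiff (S₁ := S₁) ?_ (Finset.card_pos.mp hpos)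
          Finset.disjoint_sdiff (hcard ▸ Nat.min_le_right _ _)
        rwa [Finset.union_sdiff_of_subset hS₁]
      · rw [Finset.card_sdiff_of_subset hS₁, hcard]
        simp only [List.map_cons, List.sum_cons] at hl
        omega

end Newton

/-! ### Transferring the degree bound from P to B -/

section Main

variable {p d : ℕ} [Fact p.Prime] {V : Type} [AddCommGroup V] [Fintype V]

/-- A polynomial which is measurable with respect to an unbiased factor is a combination of
monomials of weight at most its degree. -/
theorem Unbiased.exists_mem_weightedSpan {D : ℕ}
    {W : Fin d → Submodule (ZMod p) (V → ZMod p)} {ε : ℝ} (hW : IsFac W)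
    (hu : Unbiased (Fin (D + 1)) ε W) (hε : 0 ≤ ε)
    (hN : Fintype.card (Conf (Fin (D + 1)) W → ZMod p) * ε < 1) {P : V → ZMod p}
    (hP : Kill (D + 1) P) (hPW : ∀ x y, Agree W x y → P x = P y) :
    ∃ B ∈ weightedSpan p (τ := Σ i : Fin d, Fin (Module.finrank (ZMod p) (W i)))
        (fun t => (t.1 : ℕ) + 1) D,
      ∀ x, P x = B fun t => facBasis W t.1 t.2 x := by
  obtain ⟨B₀, hB₀⟩ := exists_eq_comp_facBasis hPW
  set B : ((Σ i : Fin d, Fin (Module.finrank (ZMod p) (W i))) → ZMod p) → ZMod p :=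
    fun y => B₀ fun i j => y ⟨i, j⟩ with hB
  refine ⟨B, ?_, hB₀⟩
  have hcube : CubeVanish (fun t : Σ i : Fin d, Fin (Module.finrank (ZMod p) (W i)) =>
      (t.1 : ℕ) + 1) (Finset.univ : Finset (Fin (D + 1))) B := by
    intro a ha
    -- Equidistribution realises the formal cube `a` by an actual cube in V, where the derivative of
    -- `P` vanishes.
    obtain ⟨x, h, hxh⟩ := hu.exists_Psi_eq hN hε (fun t => a t.1.2 t.1.1)
    have hv : ∀ T : Finset (Fin (D + 1)), B (∑ S' ∈ T.powerset, a S') = P (x + ∑ b ∈ T, h b) := by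
      intro T
      rw [hB₀]
      refine congrArg B₀ (funext fun i => funext fun j => ?_)
      rw [facBasis_apply_add_sum hW, hxh, vertex, Finset.sum_apply]
      refine Finset.sum_congr rfl fun S _ => ?_
      split_ifs with hS
      · rfl
      · exact ha S ⟨i, j⟩ (by simpa using hS)
    have h0 := hP.DS_eq_zero h (S := Finset.univ) (by simp) x
    have h1 : ∑ T ∈ (Finset.univ : Finset (Fin (D + 1))).powerset,
        (-1) ^ T.card * B (∑ S' ∈ T.powerset, a S') = (-1) ^ (D + 1) * DS h Finset.univ P x := by
      rw [DS, Finset.mul_sum]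
      refine Finset.sum_congr rfl fun T hT => ?_
      have hc : T.card ≤ D + 1 := (Finset.card_le_univ T).trans (by simp)
      have hpow : (-1 : ZMod p) ^ (D + 1) * (-1) ^ (D + 1 - T.card) = (-1) ^ T.card := by
        rw [← pow_add, show D + 1 + (D + 1 - T.card) = T.card + 2 * (D + 1 - T.card) by omega,
          pow_add, pow_mul]
        simp
      rw [hv, Finset.card_univ, Fintype.card_fin, ← mul_assoc, hpow]
    rw [h1, h0, mul_zero]
  refine mem_weightedSpan_of_unitDeriv fun l hl => hcube.unitDeriv_eq_zero ?_ ?_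
  · exact fun t => Nat.succ_pos _
  · simpa using hl

end Main

/-! ### Translation to `PolyFactor` and conclusion -/

section Frozen

variable {p n d : ℕ} [Fact p.Prime]

/-- The factor in the sense of `PolyFactor` given by bases of subspaces. -/
noncomputable def facToPoly (W : Fin d → Submodule (ZMod p) ((Fin n → ZMod p) → ZMod p))
    (hW : IsFac W) : PolyFactor p n d where
  M := fun i => Module.finrank (ZMod p) (W i)
  poly := fun i j => facBasis W i j
  isPoly := fun i j => (isPolyOfDegreeLE_iff_kill _ _).mpr (hW i _ (facBasis_mem W i j))

theorem facToPoly_isRegular {W : Fin d → Submodule (ZMod p) ((Fin n → ZMod p) → ZMod p)}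
    (hW : IsFac W) {F : ℕ → ℝ≥0} (hreg : Reg (fun m => ⌈F m⌉₊) W) :
    (facToPoly W hW).IsRegular F := by
  classical
  intro i c hc
  set w : (Fin n → ZMod p) → ZMod p := ∑ j, c j • facBasis W i j with hw
  have hwi : w ∈ W i :=
    Submodule.sum_mem _ fun j _ => Submodule.smul_mem _ _ (facBasis_mem W i j)
  -- Using bases matters here: a nonzero coefficient vector yields a nonzero function, to which
  -- `Reg` applies.
  have hw0 : w ≠ 0 := fun h0 =>
    hc (funext (Fintype.linearIndependent_iff.mp (linearIndependent_facBasis W i) c h0))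
  have h1 : ((⌈F (fdim W)⌉₊ : ℕ) : ℕ∞) ≤ degRank (i : ℕ) w := by
    unfold degRank
    refine le_iInf₂ fun k hk => ?_
    obtain ⟨Q, hQ, B, hB⟩ := hk
    rw [Nat.cast_le]
    by_contra hlt
    push Not at hlt
    refine hreg i w hwi hw0 (RankLE.mono hlt.le ⟨Finset.univ.image Q, ?_, ?_, ?_⟩)
    · exact Finset.card_image_le.trans (by simp)
    · intro q hq
      obtain ⟨j, -, rfl⟩ := Finset.mem_image.mp hq
      exact (isPolyOfDegreeLE_iff_kill _ _).mp (hQ j)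
    · intro x y hxy
      rw [hB, hB]
      congr 1
      ext j
      rw [hxy _ (Finset.mem_image_of_mem _ (Finset.mem_univ j))]
  have h2 : (F (fdim W) : ℝ≥0∞) ≤ ((⌈F (fdim W)⌉₊ : ℕ) : ℝ≥0∞) := by
    exact_mod_cast Nat.le_ceil (F (fdim W))
  have h3 := ENat.toENNReal_mono h1
  rw [ENat.toENNReal_coe] at h3
  exact h2.trans h3

theorem PolyFactor.isExtension_of_eval (𝓕' 𝓕 : PolyFactor p n d)
    (h : ∀ x y, 𝓕'.eval x = 𝓕'.eval y → 𝓕.eval x = 𝓕.eval y) : 𝓕'.IsExtension 𝓕 := by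
  have hf : Function.FactorsThrough 𝓕.eval 𝓕'.eval := fun x y hxy => h x y hxy
  obtain ⟨g, hg⟩ := (Function.factorsThrough_iff _).mp hf
  unfold PolyFactor.IsExtension PolyFactor.sigma
  rw [hg, ← MeasurableSpace.comap_comp]
  exact MeasurableSpace.comap_mono le_top

theorem PolyFactor.eq_of_measurable {𝓕 : PolyFactor p n d} {P : (Fin n → ZMod p) → ZMod p}
    (hP : Measurable[𝓕.sigma, ⊤] P) {x y : Fin n → ZMod p} (hxy : 𝓕.eval x = 𝓕.eval y) :
    P x = P y := by
  obtain ⟨A, -, hA⟩ := hP (t := {P x}) MeasurableSpace.measurableSet_top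
  have hx : x ∈ 𝓕.eval ⁻¹' A := by rw [hA]; rfl
  have hy : y ∈ 𝓕.eval ⁻¹' A := by
    rw [Set.mem_preimage, ← hxy]; exact hx
  rw [hA] at hy
  exact (Set.mem_singleton_iff.mp hy).symm

/-- Substituting the basis polynomials is linear and sends a monomial of weight e to a product of
𝓕-degree e. -/
theorem facToPoly_hasDegreeLE {W : Fin d → Submodule (ZMod p) ((Fin n → ZMod p) → ZMod p)}
    (hW : IsFac W) {D : ℕ} {P : (Fin n → ZMod p) → ZMod p}
    {B : ((Σ i : Fin d, Fin (Module.finrank (ZMod p) (W i))) → ZMod p) → ZMod p}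
    (hB : B ∈ weightedSpan p (fun t => (t.1 : ℕ) + 1) D)
    (hPB : ∀ x, P x = B fun t => facBasis W t.1 t.2 x) : (facToPoly W hW).HasDegreeLE D P := by
  set φ : (Fin n → ZMod p) → (Σ i : Fin d, Fin (Module.finrank (ZMod p) (W i))) → ZMod p :=
    fun x t => facBasis W t.1 t.2 x with hφ
  have hP : P = LinearMap.funLeft (ZMod p) (ZMod p) φ B := by
    ext x; rw [hPB]; rfl
  have h1 : LinearMap.funLeft (ZMod p) (ZMod p) φ B ∈
      (weightedSpan p (fun t : Σ i : Fin d, Fin (Module.finrank (ZMod p) (W i)) =>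
        (t.1 : ℕ) + 1) D).map (LinearMap.funLeft (ZMod p) (ZMod p) φ) :=
    Submodule.mem_map_of_mem hB
  rw [weightedSpan, Submodule.map_span, ← hP] at h1
  refine Submodule.span_mono ?_ h1
  rintro _ ⟨_, ⟨l, hl, rfl⟩, rfl⟩
  refine ⟨_, hl, l.length, fun j => l[j].1, fun j => facBasis W l[j].1 l[j].2, ?_, ?_, ?_⟩
  · exact fun j => Submodule.subset_span ⟨l[j].2, rfl⟩
  · ext x
    rw [Finset.prod_apply]
    exact (Fin.prod_univ_fun_getElem l (φ x)).symm
  · exact (Fin.sum_univ_fun_getElem l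
      (fun t : Σ i : Fin d, Fin (Module.finrank (ZMod p) (W i)) => (t.1 : ℕ) + 1)).symm

end Frozen

theorem mainTheorem7 (p : ℕ) [Fact p.Prime] (d D : ℕ) (hd : 1 ≤ d) (hdp : d < p)
    (hD : 1 ≤ D) (hDp : D < p) (F : ℕ → ℝ≥0) (hF : Monotone F) :
    ∃ C : ℕ → ℕ, ∀ (n : ℕ) (𝓕 : PolyFactor p n d) (P : (Fin n → ZMod p) → ZMod p),
      IsPolyOfDegreeLE D P → Measurable[𝓕.sigma, ⊤] P →
        ∃ 𝓕' : PolyFactor p n d, 𝓕'.IsExtension 𝓕 ∧ 𝓕'.IsRegular F ∧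
          𝓕'.dim ≤ C 𝓕.dim ∧ 𝓕'.HasDegreeLE D P := by
  have hG : ∀ i < d, GowersRank p (i + 1) := fun i hi => gowersRank_succ (by omega)
  -- Cubes with D + 1 directions, because `P` is annihilated by D + 1 derivatives.
  obtain ⟨C, hC⟩ := exists_regular_unbiased hG (Fin (D + 1)) (fun m => ⌈F m⌉₊) (tol p (D + 1))
    (tol_pos p _) (tol_le_one p _)
  refine ⟨C, ?_⟩
  intro n 𝓕 P hP hPm
  set W₀ : Fin d → Submodule (ZMod p) ((Fin n → ZMod p) → ZMod p) :=
    fun i => Submodule.span (ZMod p) (Set.range (𝓕.poly i)) with hW₀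
  have hW₀F : IsFac W₀ := by
    intro i w hw
    have : W₀ i ≤ killSubmodule p (Fin n → ZMod p) ((i : ℕ) + 2) := by
      refine Submodule.span_le.mpr ?_
      rintro _ ⟨j, rfl⟩
      exact (isPolyOfDegreeLE_iff_kill _ _).mp (𝓕.isPoly i j)
    exact this hw
  have hdim : fdim W₀ ≤ 𝓕.dim := Finset.sum_le_sum fun i _ =>
    (finrank_range_le_card (R := ZMod p) (𝓕.poly i)).trans_eq (Fintype.card_fin _)
  obtain ⟨W, hW, hreg, hu, href, hWd⟩ := hC _ W₀ _ hW₀F hdim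
  have heval : ∀ x y, Agree W x y → 𝓕.eval x = 𝓕.eval y := by
    intro x y hxy
    ext i j
    exact href x y hxy i _ (Submodule.subset_span ⟨j, rfl⟩)
  obtain ⟨B, hB, hPB⟩ := hu.exists_mem_weightedSpan hW (tol_pos p _ _).le
    ((card_Conf_mul_tol_le W _).trans_lt (by norm_num)) ((isPolyOfDegreeLE_iff_kill _ _).mp hP)
    fun x y hxy => PolyFactor.eq_of_measurable hPm (heval x y hxy)
  refine ⟨facToPoly W hW, ?_, facToPoly_isRegular hW hreg, hWd, facToPoly_hasDegreeLE hW hB hPB⟩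
  refine PolyFactor.isExtension_of_eval _ _ fun x y hxy => heval x y ?_
  exact agree_iff_facBasis.mpr fun i j => congrFun (congrFun hxy i) j
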